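/- For $s\in\mathbf{C}$ let \[\mathcal R(s)=\int_{0\swarrow1}\frac{x^{-s}e^{\pi i x^2}}{e^{\pi i x}-e^{-\pi i x}}\,dx\] be Riemann's auxiliary function, where $0\swarrow1$ is a straight line of direction $e^{-3\pi i/4}$ that crosses the real axis at a point between $0$ and $1$ (for instance at $\tfrac12$; the value of the integral does not depend on the point), traversed from upper right to lower left, and $x^{-s}=e^{-s\log x}$ with the principal branch of the logarithm. Theorem. Let $\sigma<0$ be a fixed real number. Then, as $T\to+\infty$, \[\frac{1}{T}\int_1^T|\mathcal R(\sigma+it)|^2\Bigl(\frac{t}{2\pi}\Bigr)^{\sigma}\,dt=\frac{2}{3(1-2\sigma)}\Bigl(\frac{T}{2\pi}\Bigr)^{1/2}+O(T^{1/4}),\] where the implied constant may depend on $\sigma$. -/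

import Mathlib

open scoped Real

/-- The integrand `x ^ (-s) * e ^ (π i x ^ 2) / (e ^ (π i x) - e ^ (-π i x))` of the integral that
defines Riemann's auxiliary function; `x ^ (-s)` is `exp (-s log x)` with the principal branch of
the logarithm (cut along the negative real axis). -/
noncomputable def auxIntegrand (s x : ℂ) : ℂ :=
  x ^ (-s) * Complex.exp (π * Complex.I * x ^ 2) /
    (Complex.exp (π * Complex.I * x) - Complex.exp (-(π * Complex.I * x)))

/-- Riemann's auxiliary function `R(s)`: the integral of `auxIntegrand s` along the straight line
`x = 1 / 2 + u * e ^ (i π / 4)`, which crosses the real axis between `0` and `1` and is traversed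
from upper right to lower left, that is, with `u` decreasing from `+∞` to `-∞`
(whence the minus sign). -/
noncomputable def auxR (s : ℂ) : ℂ :=
  -∫ u : ℝ, auxIntegrand s (1 / 2 + u * Complex.exp (π * Complex.I / 4)) *
    Complex.exp (π * Complex.I / 4)

/-! On the line `x = c + v(1 + i)` the numerator of the integrand has modulus `|x|^(-σ) exp(t arg x
- 2π(c + v)v)`. With `t = 2πa²` the saddle point is `x = a = √(t/2π)`, and on a line meeting the
real axis within `1/2` of `a` this is `O(a^(-σ) exp(-v²))` (`norm_numerator_diag_le`). Moving the
line from `1/2` to `⌊a⌋ + 1/2` crosses the poles `1, ..., ⌊a⌋`, each contributing `n^(-s)`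
(`auxLine_succ_sub_auxLine`). Hence `R(s) = ∑_{n ≤ a} n^(-s) + O(t^(-σ/2))`
(`exists_norm_auxR_sub_mainSum_le`), and the squared error has weighted size `O(1)`.

In the weighted square of the Dirichlet polynomial the diagonal is `∑_{n ≤ a} n^(-2σ) · a^(2σ) =
a/(1 - 2σ) + O(1)`, whose integral gives the main term. An off-diagonal pair enters only for `t ≥ 2π
max(m, n)²`, where the weight has already cancelled `m^(-σ) n^(-σ)`; its oscillating integral is
`O(1/|log(m/n)|)`. Summed over `m, n ≤ √(T/2π)` this is `O(T^(5/4))` even with a crude bound for the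
harmonic sum (`abs_integral_offDiag_le`).

The cross term between the polynomial, of mean square `T^(3/2)`, and the error, of mean square `T`,
is `O(T^(5/4))` by a weighted Young inequality (`exists_abs_norm_sq_sub_le`). Division by `T` gives
`T^(1/4)`. -/

/-! ### The phase on lines of slope one. -/

/-- Direction vector of the integration lines in rectangular form. -/
lemma exp_pi_I_div_four :
    Complex.exp (π * Complex.I / 4) = ((√2 / 2 : ℝ) : ℂ) * (1 + Complex.I) := by
  have : (π * Complex.I / 4 : ℂ) = ((π / 4 : ℝ) : ℂ) * Complex.I := by push_cast; ring
  rw [this, Complex.exp_mul_I, ← Complex.ofReal_cos, ← Complex.ofReal_sin, Real.cos_pi_div_four,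
    Real.sin_pi_div_four]
  ring

lemma diag_mem_slitPlane {c : ℝ} (hc : 0 < c) (v : ℝ) :
    (c + v * (1 + Complex.I) : ℂ) ∈ Complex.slitPlane := by
  rw [Complex.mem_slitPlane_iff]
  by_cases hv : v = 0
  · left; simp [hv, hc]
  · right; simpa using hv

/-- The derivative is `Im((1 + i)/x)` at `x = c + v(1 + i)`; the denominator is `|x|² = (c + v)² +
v²`. -/
lemma hasDerivAt_arg_diag {c : ℝ} (hc : 0 < c) (v : ℝ) :
    HasDerivAt (fun v : ℝ => (c + v * (1 + Complex.I) : ℂ).arg)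
      (c / (c ^ 2 + 2 * c * v + 2 * v ^ 2)) v := by
  have h1 : HasDerivAt (fun v : ℝ => (c + v * (1 + Complex.I) : ℂ)) (1 + Complex.I) v := by
    simpa using ((Complex.ofRealCLM.hasDerivAt (x := v)).mul_const (1 + Complex.I)).const_add (c : ℂ)
  have h2 := h1.clog_real (diag_mem_slitPlane hc v)
  have h3 := (Complex.imCLM.hasFDerivAt (x := Complex.log (c + v * (1 + Complex.I)))).comp_hasDerivAt
    v h2
  have h4 : (Complex.imCLM ∘ fun v : ℝ => Complex.log (c + v * (1 + Complex.I)))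
      = fun v : ℝ => (c + v * (1 + Complex.I) : ℂ).arg := by
    ext v; simp [Complex.log_im]
  rw [h4] at h3
  refine h3.congr_deriv ?_
  simp only [Complex.imCLM_apply, Complex.div_im, Complex.normSq_apply]
  have : 0 < c ^ 2 + 2 * c * v + 2 * v ^ 2 := by nlinarith [sq_nonneg (c + v), sq_nonneg v, sq_nonneg (c + 2 * v), pow_pos hc 2]
  simp
  have h5 : (c + v) * (c + v) + v * v = c ^ 2 + 2 * c * v + 2 * v ^ 2 := by ring
  rw [h5]; field_simp; ring

lemma le_zero_of_deriv_sign {f f' : ℝ → ℝ} (hf : ∀ v, HasDerivAt f (f' v) v) (h0 : f 0 = 0)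
    (hneg : ∀ v, v ≤ 0 → 0 ≤ f' v) (hpos : ∀ v, 0 ≤ v → f' v ≤ 0) (v : ℝ) : f v ≤ 0 := by
  have hcont : Continuous f := continuous_iff_continuousAt.2 fun v => (hf v).continuousAt
  rcases le_total v 0 with hv | hv
  · have : MonotoneOn f (Set.Iic 0) :=
      monotoneOn_of_hasDerivWithinAt_nonneg (convex_Iic 0) hcont.continuousOn
        (fun x _ => (hf x).hasDerivWithinAt) (fun x hx => hneg x (by simpa using (interior_subset hx)))
    simpa [h0] using this (Set.mem_Iic.2 hv) (Set.mem_Iic.2 le_rfl) hv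
  · have : AntitoneOn f (Set.Ici 0) :=
      antitoneOn_of_hasDerivWithinAt_nonpos (convex_Ici 0) hcont.continuousOn
        (fun x _ => (hf x).hasDerivWithinAt) (fun x hx => hpos x (by simpa using (interior_subset hx)))
    simpa [h0] using this (Set.mem_Ici.2 le_rfl) (Set.mem_Ici.2 hv) hv

/-- After adding `v²/2` to the left side, its derivative is `-v` times a positive factor, because
`3c² + 4cv + 2v² = 2(c + v)² + c²`. The maximum is therefore the value `0` at `v = 0`. -/
lemma sq_mul_arg_diag_le {c : ℝ} (hc : 0 < c) (v : ℝ) :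
    c ^ 2 * (c + v * (1 + Complex.I) : ℂ).arg - (c + v) * v ≤ -(v ^ 2 / 2) := by
  have key := le_zero_of_deriv_sign
    (f := fun v : ℝ => c ^ 2 * (c + v * (1 + Complex.I) : ℂ).arg - (c + v) * v + v ^ 2 / 2)
    (f' := fun v => -v * (3 * c ^ 2 + 4 * c * v + 2 * v ^ 2) / (c ^ 2 + 2 * c * v + 2 * v ^ 2))
    ?_ ?_ ?_ ?_ v
  · linarith [key]
  · intro v
    have hp : 0 < c ^ 2 + 2 * c * v + 2 * v ^ 2 := by nlinarith [sq_nonneg (c + v), sq_nonneg v, sq_nonneg (c + 2 * v), pow_pos hc 2]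
    have h := (((hasDerivAt_arg_diag hc v).const_mul (c ^ 2)).sub
      (((hasDerivAt_id v).const_add c).mul (hasDerivAt_id v))).add
      (((hasDerivAt_id v).pow 2).div_const 2)
    refine h.congr_deriv ?_
    rw [← mul_div_assoc, eq_div_iff hp.ne', add_mul, sub_mul, div_mul_cancel₀ _ hp.ne']
    simp only [id, Nat.cast_ofNat, Nat.add_one_sub_one, pow_one, mul_one, one_mul]
    ring
  · simp [Complex.arg_ofReal_of_nonneg hc.le]
  · intro v hv
    have hp : 0 < c ^ 2 + 2 * c * v + 2 * v ^ 2 := by nlinarith [sq_nonneg (c + v), sq_nonneg v, sq_nonneg (c + 2 * v), pow_pos hc 2]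
    have hq : 0 ≤ 3 * c ^ 2 + 4 * c * v + 2 * v ^ 2 := by nlinarith [sq_nonneg (c + v)]
    exact div_nonneg (mul_nonneg (by linarith) hq) hp.le
  · intro v hv
    have hp : 0 < c ^ 2 + 2 * c * v + 2 * v ^ 2 := by nlinarith [sq_nonneg (c + v), sq_nonneg v, sq_nonneg (c + 2 * v), pow_pos hc 2]
    have hq : 0 ≤ 3 * c ^ 2 + 4 * c * v + 2 * v ^ 2 := by nlinarith [sq_nonneg (c + v)]
    exact div_nonpos_of_nonpos_of_nonneg (mul_nonpos_of_nonpos_of_nonneg (by linarith) hq) hp.le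

lemma abs_arg_diag_le {c : ℝ} (hc : 0 < c) (v : ℝ) :
    |(c + v * (1 + Complex.I) : ℂ).arg| ≤ 2 / c * |v| := by
  have h := Convex.norm_image_sub_le_of_norm_hasDerivWithin_le (s := Set.univ)
    (f := fun v : ℝ => (c + v * (1 + Complex.I) : ℂ).arg) (x := 0) (y := v) (C := 2 / c)
    (fun x _ => (hasDerivAt_arg_diag hc x).hasDerivWithinAt) ?_ convex_univ trivial trivial
  · simpa [Complex.arg_ofReal_of_nonneg hc.le] using h
  · intro v _
    have hp : 0 < c ^ 2 + 2 * c * v + 2 * v ^ 2 := by nlinarith [sq_nonneg (c + v), sq_nonneg v, sq_nonneg (c + 2 * v), pow_pos hc 2]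
    rw [Real.norm_eq_abs, abs_of_pos (div_pos hc hp), div_le_div_iff₀ hp hc]
    -- `2|x|² - c² = (c + 2v)²`, so the derivative of the argument is at most `2/c`.
    nlinarith [sq_nonneg (c + 2 * v)]

/-- The phase estimate near the saddle point `a`. -/
lemma phase_diag_le {a c : ℝ} (hc : 1 / 2 ≤ c) (hca : |a - c| ≤ 1 / 2) (v : ℝ) :
    a ^ 2 * (c + v * (1 + Complex.I) : ℂ).arg - (c + v) * v ≤ -(v ^ 2 / 2) + 3 * |v| := by
  have hc0 : 0 < c := by linarith
  have h1 := sq_mul_arg_diag_le hc0 v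
  have h2 := abs_arg_diag_le hc0 v
  set θ := (c + v * (1 + Complex.I) : ℂ).arg
  -- `|a - c|(a + c) ≤ (2c + 1/2)/2 ≤ 3c/2`, the last step by `c ≥ 1/2`.
  have h3 : |a ^ 2 - c ^ 2| ≤ 3 * c / 2 := by
    rw [abs_le] at hca ⊢
    constructor <;> nlinarith
  have h4 : (a ^ 2 - c ^ 2) * θ ≤ 3 * |v| := by
    calc (a ^ 2 - c ^ 2) * θ ≤ |(a ^ 2 - c ^ 2) * θ| := le_abs_self _
      _ = |a ^ 2 - c ^ 2| * |θ| := abs_mul _ _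
      _ ≤ (3 * c / 2) * (2 / c * |v|) := by gcongr
      _ = 3 * |v| := by field_simp
  linarith

/-! ### Size of the numerator and denominator of the integrand. -/

lemma norm_numerator (s x : ℂ) (hx : x ≠ 0) :
    ‖x ^ (-s) * Complex.exp (π * Complex.I * x ^ 2)‖ =
      ‖x‖ ^ (-s.re) * Real.exp (s.im * x.arg - 2 * π * (x.re * x.im)) := by
  rw [norm_mul, Complex.norm_cpow_of_ne_zero hx, Complex.norm_exp, div_mul_eq_mul_div, mul_div_assoc,
    ← Real.exp_sub]
  congr 2
  simp [pow_two]
  ring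

lemma norm_exp_sub_exp_sq (x : ℂ) :
    ‖Complex.exp (π * Complex.I * x) - Complex.exp (-(π * Complex.I * x))‖ ^ 2 =
      4 * (Real.sin (π * x.re) ^ 2 + Real.sinh (π * x.im) ^ 2) := by
  have h : Complex.exp (π * Complex.I * x) - Complex.exp (-(π * Complex.I * x)) =
      2 * Complex.I * Complex.sin ((π * x.re : ℝ) + (π * x.im : ℝ) * Complex.I) := by
    have hx : (((π * x.re : ℝ) : ℂ) + (π * x.im : ℝ) * Complex.I) = π * x := by
      conv_rhs => rw [← Complex.re_add_im x]
      push_cast; ring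
    rw [hx, Complex.sin]
    have e1 : (π * Complex.I * x) = (π * x) * Complex.I := by ring
    rw [e1, neg_mul]
    linear_combination (Complex.exp (↑π * x * Complex.I) - Complex.exp (-(↑π * x * Complex.I))) * Complex.I_sq
  rw [h, norm_mul, mul_pow, Complex.sin_add_mul_I, ← Complex.ofReal_sin, ← Complex.ofReal_cos,
    ← Complex.ofReal_sinh, ← Complex.ofReal_cosh]
  rw [← Complex.normSq_eq_norm_sq (_ + _), Complex.normSq_apply]
  have h4 : ‖(2 * Complex.I : ℂ)‖ ^ 2 = 4 := by norm_num
  rw [h4]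
  simp only [Complex.add_re, Complex.mul_re,
    Complex.ofReal_re, Complex.ofReal_im, Complex.I_re, Complex.I_im, Complex.add_im, Complex.mul_im]
  have := Real.cosh_sq (π * x.im)
  have h2 := Real.sin_sq_add_cos_sq (π * x.re)
  have h3 : Real.cos (π * x.re) ^ 2 = 1 - Real.sin (π * x.re) ^ 2 := by linarith
  linear_combination 4 * Real.sin (π * x.re) ^ 2 * this + 4 * Real.sinh (π * x.im) ^ 2 * h3

/-- Through a half-integer the squared modulus is `4(cos²(πv) + sinh²(πv))`, and `|sinh(πv)| ≥ |πv|
≥ |sin(πv)|`. -/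
lemma two_le_norm_exp_sub_exp (k : ℕ) (v : ℝ) :
    2 ≤ ‖Complex.exp (π * Complex.I * (((k + 1 / 2 : ℝ) : ℂ) + v * (1 + Complex.I))) -
      Complex.exp (-(π * Complex.I * (((k + 1 / 2 : ℝ) : ℂ) + v * (1 + Complex.I))))‖ := by
  refine (pow_le_pow_iff_left₀ zero_le_two (norm_nonneg _) two_ne_zero).1 ?_
  rw [norm_exp_sub_exp_sq]
  have e : π * (((k + 1 / 2 : ℝ) : ℂ) + v * (1 + Complex.I)).re = π * v + π / 2 + k * π := by
    simp; ring
  have e2 : (((k + 1 / 2 : ℝ) : ℂ) + v * (1 + Complex.I)).im = v := by simp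
  rw [e, e2, Real.sin_add_nat_mul_pi, Real.sin_add_pi_div_two, mul_pow, ← pow_mul, mul_comm k 2, pow_mul]
  have h1 : Real.sin (π * v) ^ 2 ≤ (π * v) ^ 2 := sq_le_sq.2 Real.abs_sin_le_abs
  have h2 : (π * v) ^ 2 ≤ Real.sinh (π * v) ^ 2 := by
    rw [sq_le_sq, Real.abs_sinh]
    exact Real.self_le_sinh_iff.2 (abs_nonneg _)
  have h3 := Real.sin_sq_add_cos_sq (π * v)
  norm_num
  linarith

lemma norm_diag_le {c : ℝ} (hc : 0 < c) (v : ℝ) :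
    ‖(c + v * (1 + Complex.I) : ℂ)‖ ≤ c + 2 * |v| := by
  calc ‖(c + v * (1 + Complex.I) : ℂ)‖ ≤ ‖(c : ℂ)‖ + ‖(v * (1 + Complex.I) : ℂ)‖ := norm_add_le _ _
    _ ≤ c + |v| * (1 + 1) := by
        rw [norm_mul, Complex.norm_real, Complex.norm_real, Real.norm_eq_abs, Real.norm_eq_abs,
          abs_of_pos hc]
        gcongr
        exact (norm_add_le _ _).trans (by simp)
    _ = c + 2 * |v| := by ring

lemma rpow_norm_diag_le {c A p : ℝ} (hc : 0 < c) (hA : 1 ≤ A) (hcA : c ≤ A) (hp : 0 ≤ p) (v : ℝ) :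
    ‖(c + v * (1 + Complex.I) : ℂ)‖ ^ p ≤ A ^ p * Real.exp (2 * p * |v|) := by
  have h1 : ‖(c + v * (1 + Complex.I) : ℂ)‖ ≤ A * Real.exp (2 * |v|) := by
    refine (norm_diag_le hc v).trans ?_
    have := Real.add_one_le_exp (2 * |v|)
    nlinarith [abs_nonneg v]
  calc ‖(c + v * (1 + Complex.I) : ℂ)‖ ^ p ≤ (A * Real.exp (2 * |v|)) ^ p := by gcongr
    _ = A ^ p * Real.exp (2 * p * |v|) := by
        rw [Real.mul_rpow (by linarith) (Real.exp_pos _).le, ← Real.exp_mul]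
        ring_nf

/-- Absorbs into the Gaussian the linear terms in `|v|` coming from the phase and from the growth of
`|x|^(-σ)`. -/
lemma linear_sub_pi_sq_le (M v : ℝ) : M * |v| - π * v ^ 2 ≤ M ^ 2 / 4 - v ^ 2 := by
  have h := Real.pi_gt_three
  have := sq_abs v
  nlinarith [sq_nonneg (M / 2 - |v|), sq_nonneg v]

/-- Saddle point estimate of the numerator of the integrand on a line through `c`. -/
lemma norm_numerator_diag_le {σ a c : ℝ} (hσ : σ ≤ 0) (ha : 1 / 3 ≤ a) (hc : 1 / 2 ≤ c)
    (hca : |a - c| ≤ 1 / 2) (v : ℝ) :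
    ‖(c + v * (1 + Complex.I) : ℂ) ^ (-(σ + (2 * π * a ^ 2 : ℝ) * Complex.I)) *
      Complex.exp (π * Complex.I * (c + v * (1 + Complex.I)) ^ 2)‖ ≤
      (3 * a) ^ (-σ) * Real.exp ((6 * π - 2 * σ) ^ 2 / 4) * Real.exp (-v ^ 2) := by
  have hc0 : 0 < c := by linarith
  rw [norm_numerator _ _ (Complex.slitPlane_ne_zero (diag_mem_slitPlane hc0 v))]
  have h1 := rpow_norm_diag_le (A := 3 * a) (p := -σ) hc0 (by linarith)
    (by rw [abs_le] at hca; linarith) (by linarith) v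
  -- The phase contributes `2π · 3|v|` and the power `-2σ|v|`, whence the constant `6π - 2σ`.
  have h2 := phase_diag_le hc hca v
  have h3 := linear_sub_pi_sq_le (6 * π - 2 * σ) v
  simp only [Complex.add_re, Complex.add_im, Complex.mul_re, Complex.mul_im, Complex.ofReal_re,
    Complex.ofReal_im, Complex.I_re, Complex.I_im, Complex.one_re, Complex.one_im]
  simp only [mul_zero, mul_one, sub_zero, add_zero, zero_add]
  set θ := (c + v * (1 + Complex.I) : ℂ).arg
  calc _ ≤ ((3 * a) ^ (-σ) * Real.exp (2 * -σ * |v|)) *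
        Real.exp (2 * π * (-(v ^ 2 / 2) + 3 * |v|)) := by
        gcongr
        nlinarith [Real.pi_pos]
    _ = (3 * a) ^ (-σ) * Real.exp (2 * -σ * |v| + 2 * π * (-(v ^ 2 / 2) + 3 * |v|)) := by
        rw [Real.exp_add]; ring
    _ ≤ (3 * a) ^ (-σ) * Real.exp ((6 * π - 2 * σ) ^ 2 / 4 + -v ^ 2) := by
        refine mul_le_mul_of_nonneg_left (Real.exp_le_exp.2 ?_) (by positivity)
        linarith
    _ = _ := by rw [Real.exp_add]; ring

/-- A crude bound of the numerator of the integrand, uniform for lines through `(0, A]`. -/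
lemma exists_norm_numerator_diag_le (s : ℂ) (hs : s.re ≤ 0) (A : ℝ) :
    ∃ K, 0 ≤ K ∧ ∀ c : ℝ, 0 < c → c ≤ A → ∀ v : ℝ,
      ‖(c + v * (1 + Complex.I) : ℂ) ^ (-s) *
        Complex.exp (π * Complex.I * (c + v * (1 + Complex.I)) ^ 2)‖ ≤ K * Real.exp (-v ^ 2) := by
  set B := max A 1
  refine ⟨B ^ (-s.re) * Real.exp (|s.im| * π + (2 * π * B - 2 * s.re) ^ 2 / 4), by positivity, ?_⟩
  intro c hc0 hcA v
  have hcB : c ≤ B := hcA.trans (le_max_left _ _)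
  rw [norm_numerator _ _ (Complex.slitPlane_ne_zero (diag_mem_slitPlane hc0 v))]
  have h1 := rpow_norm_diag_le (A := B) (p := -s.re) hc0 (le_max_right _ _) hcB (by linarith) v
  have h3 := linear_sub_pi_sq_le (2 * π * B - 2 * s.re) v
  simp only [Complex.add_re, Complex.add_im, Complex.mul_re, Complex.mul_im, Complex.ofReal_re,
    Complex.ofReal_im, Complex.I_re, Complex.I_im, Complex.one_re, Complex.one_im]
  simp only [mul_one, sub_zero, add_zero, zero_add]
  set θ := (c + v * (1 + Complex.I) : ℂ).arg
  have h4 : s.im * θ ≤ |s.im| * π := by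
    refine (le_abs_self _).trans ?_
    rw [abs_mul]
    gcongr
    exact Complex.abs_arg_le_pi _
  have h5 : -(c * v) ≤ B * |v| := by
    refine (le_abs_self _).trans ?_
    rw [abs_neg, abs_mul, abs_of_pos hc0]
    gcongr
  calc _ ≤ (B ^ (-s.re) * Real.exp (2 * -s.re * |v|)) *
        Real.exp (|s.im| * π + 2 * π * (B * |v|) - π * v ^ 2) := by
        gcongr ?_ * Real.exp ?_
        nlinarith [Real.pi_pos, mul_nonneg Real.pi_pos.le (sq_nonneg v)]
    _ = B ^ (-s.re) * Real.exp (2 * -s.re * |v| + (|s.im| * π + 2 * π * (B * |v|) - π * v ^ 2)) := by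
        rw [Real.exp_add]; ring
    _ ≤ B ^ (-s.re) * Real.exp ((|s.im| * π + (2 * π * B - 2 * s.re) ^ 2 / 4) + -v ^ 2) := by
        refine mul_le_mul_of_nonneg_left (Real.exp_le_exp.2 ?_) (by positivity)
        linarith
    _ = _ := by rw [Real.exp_add]; ring

/-! ### Line integrals through half-integers. -/

lemma add_mul_exp_pi_I_div_four (c u : ℝ) :
    (c + u * Complex.exp (π * Complex.I / 4) : ℂ) = c + (u * (√2 / 2) : ℝ) * (1 + Complex.I) := by
  rw [exp_pi_I_div_four]; push_cast; ring

lemma norm_exp_pi_I_div_four : ‖Complex.exp (π * Complex.I / 4)‖ = 1 := by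
  rw [Complex.norm_exp]; simp

/-- The integral of `auxIntegrand s` along the line through `c` in the direction `e ^ (i π / 4)`. -/
noncomputable def auxLine (s : ℂ) (c : ℝ) : ℂ :=
  ∫ u : ℝ, auxIntegrand s (c + u * Complex.exp (π * Complex.I / 4)) *
    Complex.exp (π * Complex.I / 4)

lemma auxR_eq_neg_auxLine (s : ℂ) : auxR s = -auxLine s (1 / 2) := by
  simp [auxR, auxLine]

lemma measurable_auxIntegrand : Measurable fun p : ℂ × ℂ => auxIntegrand p.1 p.2 := by
  unfold auxIntegrand
  fun_prop

lemma norm_integrand_half_le {s : ℂ} {B : ℝ} (k : ℕ) {u : ℝ}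
    (hB : ‖(((k + 1 / 2 : ℝ) : ℂ) + (u * (√2 / 2) : ℝ) * (1 + Complex.I)) ^ (-s) *
      Complex.exp (π * Complex.I * (((k + 1 / 2 : ℝ) : ℂ) + (u * (√2 / 2) : ℝ) *
        (1 + Complex.I)) ^ 2)‖ ≤ B * Real.exp (-(u * (√2 / 2)) ^ 2)) :
    ‖auxIntegrand s ((k + 1 / 2 : ℝ) + u * Complex.exp (π * Complex.I / 4)) *
      Complex.exp (π * Complex.I / 4)‖ ≤ B * Real.exp (-(1 / 2) * u ^ 2) := by
  rw [norm_mul, norm_exp_pi_I_div_four, mul_one, add_mul_exp_pi_I_div_four, auxIntegrand, norm_div]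
  have h2 := two_le_norm_exp_sub_exp k (u * (√2 / 2))
  -- The arc length `u` and the parameter `v` satisfy `v² = u²/2`.
  have e : -(u * (√2 / 2)) ^ 2 = -(1 / 2) * u ^ 2 := by
    rw [mul_pow, div_pow, Real.sq_sqrt (by norm_num)]; ring
  rw [e] at hB
  refine (div_le_self (norm_nonneg _) (by linarith)).trans hB

lemma integrable_auxLine_half {s : ℂ} (hs : s.re ≤ 0) (k : ℕ) :
    MeasureTheory.Integrable fun u : ℝ =>
      auxIntegrand s ((k + 1 / 2 : ℝ) + u * Complex.exp (π * Complex.I / 4)) *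
        Complex.exp (π * Complex.I / 4) := by
  obtain ⟨K, hK, h⟩ := exists_norm_numerator_diag_le s hs (k + 1 / 2)
  refine MeasureTheory.Integrable.mono' ((integrable_exp_neg_mul_sq (b := 1 / 2)
    (by norm_num)).const_mul K) ?_ (Filter.Eventually.of_forall fun u =>
    norm_integrand_half_le k (h _ (by positivity) le_rfl _))
  have hm : Measurable fun u : ℝ =>
      (s, (((k + 1 / 2 : ℝ) : ℂ) + u * Complex.exp (π * Complex.I / 4))) := by fun_prop
  have := measurable_auxIntegrand.comp hm
  exact (this.mul_const _).aestronglyMeasurable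

/-- The integral along a line close to the saddle point `√(t / 2π)` is `O(t ^ (-σ / 2))`. -/
lemma exists_norm_auxLine_le {σ : ℝ} (hσ : σ ≤ 0) :
    ∃ K, 0 ≤ K ∧ ∀ t : ℝ, 1 ≤ t →
      ‖auxLine (σ + t * Complex.I) (⌊√(t / (2 * π))⌋₊ + 1 / 2 : ℝ)‖ ≤ K * (t / (2 * π)) ^ (-σ / 2) := by
  set C := Real.exp ((6 * π - 2 * σ) ^ 2 / 4)
  refine ⟨3 ^ (-σ) * C * ∫ u : ℝ, Real.exp (-(1 / 2) * u ^ 2), ?_, ?_⟩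
  · have : 0 ≤ ∫ u : ℝ, Real.exp (-(1 / 2) * u ^ 2) :=
      MeasureTheory.integral_nonneg fun u => (Real.exp_pos _).le
    positivity
  intro t ht
  have hy : 0 < t / (2 * π) := by positivity
  set a := √(t / (2 * π)) with ha_def
  have ha2 : a ^ 2 = t / (2 * π) := Real.sq_sqrt hy.le
  have ha : 1 / 3 ≤ a := by
    refine Real.le_sqrt_of_sq_le ?_
    rw [le_div_iff₀ (by positivity)]
    linarith [Real.pi_lt_four]
  have hta : 2 * π * a ^ 2 = t := by rw [ha2]; field_simp
  have hc : (1 / 2 : ℝ) ≤ ⌊a⌋₊ + 1 / 2 := by linarith [Nat.cast_nonneg (α := ℝ) ⌊a⌋₊]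
  -- The midpoint `⌊a⌋ + 1/2` is both close to the saddle and far from the poles.
  have hca : |a - (⌊a⌋₊ + 1 / 2)| ≤ 1 / 2 := by
    have h1 := Nat.floor_le (a := a) (by linarith)
    have h2 := Nat.lt_floor_add_one a
    rw [abs_le]; constructor <;> linarith
  have hpow : (3 * a) ^ (-σ) = 3 ^ (-σ) * (t / (2 * π)) ^ (-σ / 2) := by
    rw [Real.mul_rpow (by norm_num) (by linarith), ha_def, Real.sqrt_eq_rpow, ← Real.rpow_mul hy.le]
    ring_nf
  have hb : ∀ u : ℝ, ‖auxIntegrand (σ + t * Complex.I) ((⌊a⌋₊ + 1 / 2 : ℝ) + u * Complex.exp (π * Complex.I / 4)) *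
      Complex.exp (π * Complex.I / 4)‖ ≤ (3 * a) ^ (-σ) * C * Real.exp (-(1 / 2) * u ^ 2) := by
    intro u
    refine norm_integrand_half_le _ ?_
    have := norm_numerator_diag_le hσ ha hc hca (u * (√2 / 2))
    rw [hta] at this
    exact this
  refine (MeasureTheory.norm_integral_le_of_norm_le ((integrable_exp_neg_mul_sq (b := 1 / 2)
    (by norm_num)).const_mul _) (Filter.Eventually.of_forall hb)).trans ?_
  rw [MeasureTheory.integral_const_mul, hpow]
  apply le_of_eq; ring

/-! ### Shifting a line of integration across a simple pole. -/

lemma integral_two_mul_div_sq_add_sq {h : ℝ} (hh : 0 < h) :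
    MeasureTheory.Integrable (fun x : ℝ => 2 * h / (x ^ 2 + h ^ 2)) ∧
      ∫ x : ℝ, 2 * h / (x ^ 2 + h ^ 2) = 2 * π := by
  have e : (fun x : ℝ => 2 * h / (x ^ 2 + h ^ 2)) = fun x => 2 / h * (1 + (x / h) ^ 2)⁻¹ := by
    ext x
    have : 0 < x ^ 2 + h ^ 2 := by positivity
    have : 0 < h ^ 2 + x ^ 2 := by positivity
    field_simp
    ring
  rw [e]
  constructor
  · exact (integrable_inv_one_add_sq.comp_div hh.ne').const_mul _
  · rw [MeasureTheory.integral_const_mul,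
      MeasureTheory.Measure.integral_comp_div (fun x : ℝ => (1 + x ^ 2)⁻¹),
      integral_univ_inv_one_add_sq, abs_of_pos hh, smul_eq_mul]
    field_simp

/-- Moving a horizontal line of integration across a simple pole at the origin. -/
lemma integral_line_sub_integral_line {F : ℂ → ℂ} {U : Set ℂ} (hU : IsOpen U) {h : ℝ} (hh : 0 < h)
    (hUh : ∀ z : ℂ, |z.im| ≤ h → z ∈ U) (hF : DifferentiableOn ℂ F U)
    (hlow : MeasureTheory.Integrable fun x : ℝ => F (x - h * Complex.I) / (x - h * Complex.I))
    (hupp : MeasureTheory.Integrable fun x : ℝ => F (x + h * Complex.I) / (x + h * Complex.I))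
    {B : ℝ → ℝ} (hB : Filter.Tendsto B Filter.atTop (nhds 0))
    (hFB : ∀ᶠ R in Filter.atTop, ∀ z : ℂ, |z.re| = R → |z.im| ≤ h → ‖F z / z‖ ≤ B R) :
    (∫ x : ℝ, F (x - h * Complex.I) / (x - h * Complex.I)) -
      ∫ x : ℝ, F (x + h * Complex.I) / (x + h * Complex.I) = 2 * π * Complex.I * F 0 := by
  -- `G(z) = (F(z) - F(0))/z` has no pole, so Cauchy's theorem on rectangles applies to it.
  set G := dslope F 0 with hG
  have h0U : (0 : ℂ) ∈ U := hUh 0 (by simpa using hh.le)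
  have hGd : DifferentiableOn ℂ G U := (Complex.differentiableOn_dslope (hU.mem_nhds h0U)).2 hF
  have hGz : ∀ z : ℂ, z ≠ 0 → G z = F z / z - F 0 / z := by
    intro z hz
    rw [hG, dslope_of_ne _ hz, slope_def_field, sub_zero, sub_div]
  have hm : ∀ x : ℝ, (x - h * Complex.I : ℂ) ≠ 0 := fun x hx => by
    have := congrArg Complex.im hx
    simp at this; linarith
  have hp : ∀ x : ℝ, (x + h * Complex.I : ℂ) ≠ 0 := fun x hx => by
    have := congrArg Complex.im hx
    simp at this; linarith
  -- The polar parts `1/(x ∓ ih)` are not separately integrable; their difference is `2ih/(x² +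
  -- h²)`, which is.
  have hdiff : ∀ x : ℝ, G (x - h * Complex.I) - G (x + h * Complex.I) =
      F (x - h * Complex.I) / (x - h * Complex.I) - F (x + h * Complex.I) / (x + h * Complex.I) -
        Complex.I * F 0 * (2 * h / (x ^ 2 + h ^ 2) : ℝ) := by
    intro x
    rw [hGz _ (hm x), hGz _ (hp x)]
    have h1 : ((x ^ 2 + h ^ 2 : ℝ) : ℂ) = (x - h * Complex.I) * (x + h * Complex.I) := by
      push_cast
      linear_combination ((h : ℂ) ^ 2) * Complex.I_sq
    rw [Complex.ofReal_div, h1]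
    have := hm x
    have := hp x
    push_cast
    field_simp
    ring
  obtain ⟨hci, hcv⟩ := integral_two_mul_div_sq_add_sq hh
  have hci' : MeasureTheory.Integrable fun x : ℝ =>
      Complex.I * F 0 * (2 * h / (x ^ 2 + h ^ 2) : ℝ) := hci.ofReal.const_mul _
  have hint : MeasureTheory.Integrable fun x : ℝ =>
      G (x - h * Complex.I) - G (x + h * Complex.I) := by
    simp_rw [hdiff]
    exact (hlow.sub hupp).sub hci'
  have hval : ∫ x : ℝ, (G (x - h * Complex.I) - G (x + h * Complex.I)) =
      (∫ x : ℝ, F (x - h * Complex.I) / (x - h * Complex.I)) -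
      (∫ x : ℝ, F (x + h * Complex.I) / (x + h * Complex.I)) - 2 * π * Complex.I * F 0 := by
    have h12 : MeasureTheory.Integrable fun x : ℝ =>
      F (x - h * Complex.I) / (x - h * Complex.I) - F (x + h * Complex.I) / (x + h * Complex.I) :=
      hlow.sub hupp
    simp_rw [hdiff]
    rw [MeasureTheory.integral_sub h12 hci', MeasureTheory.integral_sub hlow hupp,
      MeasureTheory.integral_const_mul, integral_complex_ofReal, hcv]
    push_cast; ring
  have hGc : ContinuousOn G U := hGd.continuousOn
  have hline : ∀ (y : ℝ), |y| ≤ h → Continuous fun x : ℝ => G (x + y * Complex.I) := by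
    intro y hy
    refine hGc.comp_continuous (by fun_prop) fun x => hUh _ (by simpa using hy)
  have hrect : ∀ R : ℝ, ∫ x in (-R)..R, (G (x - h * Complex.I) - G (x + h * Complex.I)) =
      Complex.I * (∫ y in (-h)..h, G ((-R : ℝ) + y * Complex.I)) -
        Complex.I * ∫ y in (-h)..h, G (R + y * Complex.I) := by
    intro R
    have key := Complex.integral_boundary_rect_eq_zero_of_differentiableOn G
      ((-R : ℝ) + (-h : ℝ) * Complex.I) (R + h * Complex.I) (hGd.mono ?_)
    · have e1 : ∀ x : ℝ, (x - h * Complex.I : ℂ) = x + ((-h : ℝ) : ℂ) * Complex.I := by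
        intro x; push_cast; ring
      rw [intervalIntegral.integral_sub]
      · simp only [smul_eq_mul, Complex.add_re, Complex.add_im, Complex.mul_re, Complex.mul_im,
          Complex.ofReal_re, Complex.ofReal_im, Complex.I_re, Complex.I_im, mul_zero, mul_one,
          sub_zero, add_zero, zero_add] at key
        simp_rw [e1]
        linear_combination key
      · simp_rw [e1]
        exact (hline (-h) (by rw [abs_neg, abs_of_pos hh])).intervalIntegrable _ _
      · exact (hline h (abs_of_pos hh).le).intervalIntegrable _ _
    · intro z hz
      refine hUh z ?_
      have := hz.2
      simp only [Set.mem_preimage, Complex.add_im, Complex.mul_im, Complex.ofReal_re,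
        Complex.ofReal_im, Complex.I_re, Complex.I_im, mul_zero, mul_one, add_zero, zero_add] at this
      rw [Set.uIcc_of_le (by linarith)] at this
      exact abs_le.2 this
  have hvert : ∀ᶠ R in Filter.atTop, ‖∫ x in (-R)..R, (G (x - h * Complex.I) - G (x + h * Complex.I))‖
      ≤ (B R + ‖F 0‖ / R) * (4 * h) := by
    filter_upwards [hFB, Filter.eventually_gt_atTop 0] with R hR hR0
    have hside : ∀ r : ℝ, |r| = R → ‖∫ y in (-h)..h, G (r + y * Complex.I)‖ ≤
        (B R + ‖F 0‖ / R) * (2 * h) := by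
      intro r hr
      have := intervalIntegral.norm_integral_le_of_norm_le_const (a := -h) (b := h)
        (f := fun y : ℝ => G (r + y * Complex.I)) (C := B R + ‖F 0‖ / R) ?_
      · refine this.trans (le_of_eq ?_)
        rw [abs_of_pos (by linarith)]; ring
      · intro y hy
        rw [Set.uIoc_of_le (by linarith)] at hy
        have hre : (r + y * Complex.I : ℂ).re = r := by simp
        have him : (r + y * Complex.I : ℂ).im = y := by simp
        have hRn : R ≤ ‖(r + y * Complex.I : ℂ)‖ := by
          have := Complex.abs_re_le_norm (r + y * Complex.I)
          rwa [hre, hr] at this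
        rw [hGz _ (norm_pos_iff.1 (hR0.trans_le hRn))]
        refine (norm_sub_le _ _).trans (add_le_add (hR _ (by rw [hre, hr]) ?_) ?_)
        · rw [him]; exact abs_le.2 ⟨hy.1.le, hy.2⟩
        · rw [norm_div]; gcongr
    rw [hrect R]
    refine (norm_sub_le _ _).trans ?_
    rw [norm_mul, norm_mul, Complex.norm_I, one_mul, one_mul]
    have h1 := hside (-R) (by rw [abs_neg, abs_of_pos hR0])
    have h2 := hside R (abs_of_pos hR0)
    linarith
  have hlim0 : Filter.Tendsto (fun R => ∫ x in (-R)..R, (G (x - h * Complex.I) - G (x + h * Complex.I)))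
      Filter.atTop (nhds 0) := by
    refine squeeze_zero_norm' hvert ?_
    have := (hB.add (Filter.Tendsto.div_atTop (tendsto_const_nhds (x := ‖F 0‖)) Filter.tendsto_id)).mul_const (4 * h)
    simpa using this
  have hlim := MeasureTheory.intervalIntegral_tendsto_integral hint Filter.tendsto_neg_atTop_atBot
    Filter.tendsto_id
  have := tendsto_nhds_unique hlim hlim0
  rw [hval] at this
  linear_combination this

/-! ### Residues at the positive integers. -/

lemma exp_pi_I_mul_nat (m : ℕ) : Complex.exp (π * Complex.I * m) = (-1) ^ m := by
  rw [mul_comm, Complex.exp_nat_mul, Complex.exp_pi_mul_I]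

lemma exp_neg_pi_I_mul_nat (m : ℕ) : Complex.exp (-(π * Complex.I * m)) = (-1) ^ m := by
  rw [Complex.exp_neg, exp_pi_I_mul_nat, ← inv_pow]; norm_num

lemma exp_pi_I_mul_nat_sq (m : ℕ) : Complex.exp (π * Complex.I * (m : ℂ) ^ 2) = (-1) ^ m := by
  have := exp_pi_I_mul_nat (m ^ 2)
  push_cast at this
  rw [this, sq, pow_mul]
  rcases Nat.even_or_odd m with h | h
  · simp [h.neg_one_pow]
  · simp [h.neg_one_pow]

/-- Rotated coordinate around the pole `m`, in terms of the lines of integration. -/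
lemma add_exp_mul_eq_diag (m z : ℂ) :
    m + Complex.exp (π * Complex.I / 4) * z =
      (m - (√2 * z.im : ℝ)) + ((z.re + z.im) * (√2 / 2) : ℝ) * (1 + Complex.I) := by
  conv_lhs => rw [← Complex.re_add_im z]
  rw [exp_pi_I_div_four]
  push_cast
  linear_combination (√2 / 2 * z.im : ℂ) * Complex.I_sq

lemma exp_sub_exp_eq_zero_of_diag {c v : ℝ}
    (h : Complex.exp (π * Complex.I * (c + v * (1 + Complex.I))) -
      Complex.exp (-(π * Complex.I * (c + v * (1 + Complex.I)))) = 0) :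
    v = 0 ∧ Real.sin (π * c) = 0 := by
  have h1 := norm_exp_sub_exp_sq (c + v * (1 + Complex.I))
  rw [h] at h1
  simp at h1
  have h2 : Real.sinh (π * v) = 0 := by
    nlinarith [sq_nonneg (Real.sin (π * (c + v))), sq_nonneg (Real.sinh (π * v))]
  have hv : v = 0 := by
    rw [Real.sinh_eq_zero] at h2
    simpa [Real.pi_ne_zero] using h2
  subst hv
  refine ⟨rfl, ?_⟩
  simpa using h1

/-- A point with imaginary part `y` in the rotated coordinate lies on the line through `m - √2 y`.
Thus the strip of half-width `2/5` stays strictly between the lines through `m - 1` and `m + 1`. -/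
lemma sqrt_two_mul_lt_one {y : ℝ} (hy : |y| < 2 / 5) : |√2 * y| < 1 := by
  have h2 : √2 < 3 / 2 := by
    rw [Real.sqrt_lt' (by norm_num)]; norm_num
  rw [abs_mul, abs_of_nonneg (Real.sqrt_nonneg 2)]
  nlinarith [abs_nonneg y, Real.sqrt_nonneg 2]

/-- Near `m`, the integrand vanishes in the denominator only at `m`. -/
lemma exp_sub_exp_ne_zero_of_strip (m : ℕ) {z : ℂ} (hz : z ≠ 0) (hy : |z.im| < 2 / 5) :
    Complex.exp (π * Complex.I * (m + Complex.exp (π * Complex.I / 4) * z)) -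
      Complex.exp (-(π * Complex.I * (m + Complex.exp (π * Complex.I / 4) * z))) ≠ 0 := by
  intro h
  rw [add_exp_mul_eq_diag, ← Complex.ofReal_natCast, ← Complex.ofReal_sub] at h
  obtain ⟨h1, h2⟩ := exp_sub_exp_eq_zero_of_diag h
  have e : π * (m - √2 * z.im) = -(π * (√2 * z.im)) + m * π := by ring
  rw [e, Real.sin_add_nat_mul_pi] at h2
  have h3 : Real.sin (π * (√2 * z.im)) = 0 := by simpa using h2
  have h4 := abs_lt.1 (sqrt_two_mul_lt_one hy)
  rw [Real.sin_eq_zero_iff_of_lt_of_lt (by nlinarith [Real.pi_pos]) (by nlinarith [Real.pi_pos])] at h3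
  have h5 : z.im = 0 := by simpa [Real.pi_ne_zero] using h3
  have h6 : z.re = 0 := by simpa [h5] using h1
  exact hz (Complex.ext h6 h5)

lemma add_exp_mul_mem_slitPlane {m : ℕ} (hm : 1 ≤ m) {z : ℂ} (hy : |z.im| < 2 / 5) :
    m + Complex.exp (π * Complex.I / 4) * z ∈ Complex.slitPlane := by
  rw [add_exp_mul_eq_diag, ← Complex.ofReal_natCast, ← Complex.ofReal_sub]
  have h4 := abs_lt.1 (sqrt_two_mul_lt_one hy)
  have : (1 : ℝ) ≤ m := by exact_mod_cast hm
  exact diag_mem_slitPlane (by linarith) _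

lemma hasDerivAt_exp_sub_exp (m : ℕ) :
    HasDerivAt (fun z : ℂ => Complex.exp (π * Complex.I * (m + Complex.exp (π * Complex.I / 4) * z)) -
      Complex.exp (-(π * Complex.I * (m + Complex.exp (π * Complex.I / 4) * z))))
      (2 * π * Complex.I * (-1) ^ m * Complex.exp (π * Complex.I / 4)) 0 := by
  have h : HasDerivAt (fun z : ℂ => π * Complex.I * (m + Complex.exp (π * Complex.I / 4) * z))
      (π * Complex.I * Complex.exp (π * Complex.I / 4)) 0 := by
    simpa using (((hasDerivAt_id (0 : ℂ)).const_mul (Complex.exp (π * Complex.I / 4))).const_add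
      (m : ℂ)).const_mul (π * Complex.I)
  refine (h.cexp.sub h.neg.cexp).congr_deriv ?_
  simp only [Pi.neg_apply, mul_zero, add_zero, exp_pi_I_mul_nat, exp_neg_pi_I_mul_nat]
  ring

/-- Controls the short sides of the rectangles. The lines met here need not pass through
half-integers, so the denominator is bounded below by `sinh` far from the real axis; `R ≥ 5` ensures
`v² ≥ (R - 2/5)²/2 ≥ R`. -/
lemma norm_integrand_strip_le {s : ℂ} {m : ℕ} (hm : 1 ≤ m) {K : ℝ}
    (hK : ∀ c : ℝ, 0 < c → c ≤ m + 1 → ∀ v : ℝ,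
      ‖(c + v * (1 + Complex.I) : ℂ) ^ (-s) *
        Complex.exp (π * Complex.I * (c + v * (1 + Complex.I)) ^ 2)‖ ≤ K * Real.exp (-v ^ 2))
    (hK0 : 0 ≤ K) {z : ℂ} (hy : |z.im| < 2 / 5) {R : ℝ} (hR : 5 ≤ R) (hz : |z.re| = R) :
    ‖auxIntegrand s (m + Complex.exp (π * Complex.I / 4) * z) * Complex.exp (π * Complex.I / 4)‖ ≤
      K * Real.exp (-R) := by
  rw [norm_mul, norm_exp_pi_I_div_four, mul_one, auxIntegrand, norm_div]
  have h4 := abs_lt.1 (sqrt_two_mul_lt_one hy)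
  have hm1 : (1 : ℝ) ≤ m := by exact_mod_cast hm
  have hD := norm_exp_sub_exp_sq (m + Complex.exp (π * Complex.I / 4) * z)
  rw [add_exp_mul_eq_diag, ← Complex.ofReal_natCast, ← Complex.ofReal_sub] at hD ⊢
  have hN := hK (m - √2 * z.im) (by linarith) (by linarith) ((z.re + z.im) * (√2 / 2))
  set v := (z.re + z.im) * (√2 / 2) with hv
  have hv2 : v ^ 2 = (z.re + z.im) ^ 2 / 2 := by
    rw [hv, mul_pow, div_pow, Real.sq_sqrt (by norm_num)]; ring
  have hvR : R ≤ v ^ 2 := by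
    have h1 : R - 2 / 5 ≤ |z.re + z.im| := by
      have := abs_sub_abs_le_abs_sub z.re (-z.im)
      rw [abs_neg, sub_neg_eq_add] at this
      linarith
    rw [hv2, ← sq_abs]
    nlinarith
  have him : (((m - √2 * z.im : ℝ) : ℂ) + v * (1 + Complex.I)).im = v := by simp
  rw [him] at hD
  set d := ‖Complex.exp (π * Complex.I * (((m - √2 * z.im : ℝ) : ℂ) + v * (1 + Complex.I))) -
    Complex.exp (-(π * Complex.I * (((m - √2 * z.im : ℝ) : ℂ) + v * (1 + Complex.I))))‖
  have hd : 1 ≤ d := by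
    have h2 : (π * v) ^ 2 ≤ Real.sinh (π * v) ^ 2 := by
      rw [sq_le_sq, Real.abs_sinh]
      exact Real.self_le_sinh_iff.2 (abs_nonneg _)
    have h3 : 1 ≤ (π * v) ^ 2 := by
      rw [mul_pow]; nlinarith [Real.pi_gt_three]
    refine (pow_le_pow_iff_left₀ zero_le_one (norm_nonneg _) two_ne_zero).1 ?_
    rw [hD]
    nlinarith [sq_nonneg (Real.sin (π * (((m - √2 * z.im : ℝ) : ℂ) + v * (1 + Complex.I)).re))]
  refine (div_le_self (norm_nonneg _) hd).trans (hN.trans ?_)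
  gcongr

/-- The residue of the integrand at a positive integer `m` is `m ^ (-s) / (2 π i)`. -/
lemma auxLine_succ_sub_auxLine {s : ℂ} (hs : s.re ≤ 0) (k : ℕ) :
    auxLine s ((k + 1 : ℕ) + 1 / 2 : ℝ) - auxLine s (k + 1 / 2 : ℝ) = ((k + 1 : ℕ) : ℂ) ^ (-s) := by
  set m := k + 1 with hm
  have hm1 : 1 ≤ m := by omega
  set ω := Complex.exp (π * Complex.I / 4) with hω
  set D : ℂ → ℂ := fun z => Complex.exp (π * Complex.I * (m + ω * z)) -
      Complex.exp (-(π * Complex.I * (m + ω * z))) with hD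
  set N : ℂ → ℂ := fun z => (m + ω * z) ^ (-s) * Complex.exp (π * Complex.I * (m + ω * z) ^ 2) * ω
    with hN
  -- `D(z) = z E(z)` with `E` zero-free in the strip, so the integrand is `(N/E)/z` with `N/E`
  -- holomorphic there.
  set E := dslope D 0 with hE
  set U : Set ℂ := {z | |z.im| < 2 / 5} with hU
  have hUo : IsOpen U := isOpen_lt (by fun_prop) continuous_const
  have hD0 : D 0 = 0 := by
    simp [hD, exp_pi_I_mul_nat, exp_neg_pi_I_mul_nat]
  have hE0 : E 0 = 2 * π * Complex.I * (-1) ^ m * ω := by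
    rw [hE, dslope_same]
    exact (hasDerivAt_exp_sub_exp m).deriv
  have hEz : ∀ z, z ≠ 0 → E z = D z / z := by
    intro z hz
    rw [hE, dslope_of_ne _ hz, slope_def_field, hD0, sub_zero, sub_zero]
  have hωne : ω ≠ 0 := Complex.exp_ne_zero _
  have hEne : ∀ z ∈ U, E z ≠ 0 := by
    intro z hz
    by_cases h0 : z = 0
    · subst h0
      rw [hE0]
      have : (-1 : ℂ) ^ m ≠ 0 := pow_ne_zero _ (by norm_num)
      have : (π : ℂ) ≠ 0 := by exact_mod_cast Real.pi_ne_zero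
      simp [*]
    · rw [hEz z h0]
      exact div_ne_zero (exp_sub_exp_ne_zero_of_strip m h0 hz) h0
  have hEd : DifferentiableOn ℂ E U := by
    refine DifferentiableOn.mono ?_ (Set.subset_univ U)
    refine (Complex.differentiableOn_dslope Filter.univ_mem).2 ?_
    simp only [hD]
    fun_prop
  have hNd : DifferentiableOn ℂ N U := by
    intro z hz
    have h1 : DifferentiableAt ℂ (fun z => (m + ω * z) ^ (-s)) z := by
      refine DifferentiableAt.cpow (by fun_prop) (by fun_prop) (add_exp_mul_mem_slitPlane hm1 hz)
    refine DifferentiableAt.differentiableWithinAt ?_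
    simp only [hN]
    fun_prop
  have hFz : ∀ z, z ≠ 0 → N z / E z / z = auxIntegrand s (m + ω * z) * ω := by
    intro z hz
    rw [hEz z hz, auxIntegrand]
    simp only [hN, hD]
    field_simp
  -- Since `√2 h = 1/2`, the lines `Im z = -h` and `Im z = h` are those through `m + 1/2` and `m -
  -- 1/2`, reparametrized by a translation.
  set h : ℝ := √2 / 4 with hh
  have hh0 : 0 < h := by positivity
  have hh2 : h < 2 / 5 := by
    have : √2 < 8 / 5 := by
      rw [Real.sqrt_lt' (by norm_num)]; norm_num
    rw [hh]; linarith
  have hωh : ω * (h * Complex.I - h) = -(1 / 2) := by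
    have h2 : ((√2 : ℝ) : ℂ) ^ 2 = 2 := by
      rw [← Complex.ofReal_pow, Real.sq_sqrt (by norm_num)]; norm_num
    rw [hω, exp_pi_I_div_four, hh]
    push_cast
    linear_combination (√2 ^ 2 / 8 : ℂ) * Complex.I_sq - (1 / 4 : ℂ) * h2
  have hlow : ∀ x : ℝ, N (x - h * Complex.I) / E (x - h * Complex.I) / (x - h * Complex.I) =
      auxIntegrand s ((m + 1 / 2 : ℝ) + (x - h : ℝ) * ω) * ω := by
    intro x
    rw [hFz]
    · congr 2
      push_cast
      linear_combination -hωh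
    · intro hx
      have := congrArg Complex.im hx
      simp at this; linarith
  have hupp : ∀ x : ℝ, N (x + h * Complex.I) / E (x + h * Complex.I) / (x + h * Complex.I) =
      auxIntegrand s ((k + 1 / 2 : ℝ) + (x + h : ℝ) * ω) * ω := by
    intro x
    rw [hFz]
    · congr 2
      rw [hm]
      push_cast
      linear_combination hωh
    · intro hx
      have := congrArg Complex.im hx
      simp at this; linarith
  obtain ⟨K, hK0, hK⟩ := exists_norm_numerator_diag_le s hs (m + 1)
  have hB : Filter.Tendsto (fun R => K * Real.exp (-R)) Filter.atTop (nhds 0) := by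
    simpa using Real.tendsto_exp_neg_atTop_nhds_zero.const_mul K
  have key := integral_line_sub_integral_line (F := fun z => N z / E z) hUo hh0
    (fun z hz => lt_of_le_of_lt hz hh2) (hNd.div hEd hEne)
    (by simp_rw [hlow]; exact (integrable_auxLine_half hs m).comp_sub_right h)
    (by simp_rw [hupp]; exact (integrable_auxLine_half hs k).comp_add_right h) hB ?_
  · simp_rw [hlow, hupp] at key
    rw [MeasureTheory.integral_sub_right_eq_self (fun x : ℝ => auxIntegrand s ((m + 1 / 2 : ℝ) + x * ω) * ω) h,
      MeasureTheory.integral_add_right_eq_self (fun x : ℝ => auxIntegrand s ((k + 1 / 2 : ℝ) + x * ω) * ω) h] at key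
    rw [auxLine, auxLine, key, hE0]
    -- The sign `(-1)^m` of `e^(πi m²)` cancels the one in `E(0)`.
    simp only [hN, mul_zero, add_zero, exp_pi_I_mul_nat_sq]
    have : (-1 : ℂ) ^ m ≠ 0 := pow_ne_zero _ (by norm_num)
    have : (π : ℂ) ≠ 0 := by exact_mod_cast Real.pi_ne_zero
    have := Complex.I_ne_zero
    field_simp
  · filter_upwards [Filter.eventually_ge_atTop 5] with R hR z hz hz'
    rw [hFz]
    · exact norm_integrand_strip_le hm1 hK hK0 (lt_of_le_of_lt hz' hh2) hR hz
    · rintro rfl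
      simp at hz; linarith

/-- `R(s)` as a Dirichlet polynomial plus an integral along a line further to the right. -/
lemma auxR_eq_sum_sub_auxLine {s : ℂ} (hs : s.re ≤ 0) (l : ℕ) :
    auxR s = ∑ n ∈ Finset.range l, ((n + 1 : ℕ) : ℂ) ^ (-s) - auxLine s (l + 1 / 2 : ℝ) := by
  induction l with
  | zero => simp [auxR_eq_neg_auxLine]
  | succ k ih =>
    rw [Finset.sum_range_succ, ← auxLine_succ_sub_auxLine hs k, ih]
    ring

/-! ### Squares of Dirichlet polynomials and elementary estimates. -/

lemma natCast_cpow_re_im (σ t : ℝ) (n : ℕ) :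
    (((n + 1 : ℕ) : ℂ) ^ (-(σ + t * Complex.I))).re =
        ((n + 1 : ℕ) : ℝ) ^ (-σ) * Real.cos (t * Real.log (n + 1 : ℕ)) ∧
      (((n + 1 : ℕ) : ℂ) ^ (-(σ + t * Complex.I))).im =
        -(((n + 1 : ℕ) : ℝ) ^ (-σ) * Real.sin (t * Real.log (n + 1 : ℕ))) := by
  have h0 : (0 : ℝ) < (n + 1 : ℕ) := by positivity
  have h : (((n + 1 : ℕ) : ℂ) ^ (-(σ + t * Complex.I))) =
      Complex.exp ((Real.log (n + 1 : ℕ) * (-σ) : ℝ) + (-(t * Real.log (n + 1 : ℕ)) : ℝ) * Complex.I) := by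
    rw [Complex.cpow_def_of_ne_zero (by exact_mod_cast h0.ne'), Complex.natCast_log.symm]
    push_cast; ring_nf
  rw [h, Complex.exp_re, Complex.exp_im, Real.rpow_def_of_pos h0]
  simp only [Complex.add_re, Complex.add_im, Complex.mul_re, Complex.mul_im, Complex.ofReal_re,
    Complex.ofReal_im, Complex.I_re, Complex.I_im, mul_zero, mul_one, sub_zero, add_zero, zero_add,
    Real.cos_neg, Real.sin_neg, mul_neg]
  exact ⟨trivial, trivial⟩

lemma norm_sq_dirichlet_sum (σ t : ℝ) (s : Finset ℕ) :
    ‖∑ n ∈ s, ((n + 1 : ℕ) : ℂ) ^ (-(σ + t * Complex.I))‖ ^ 2 =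
      ∑ m ∈ s, ∑ n ∈ s, ((m + 1 : ℕ) : ℝ) ^ (-σ) * ((n + 1 : ℕ) : ℝ) ^ (-σ) *
        Real.cos ((Real.log (m + 1 : ℕ) - Real.log (n + 1 : ℕ)) * t) := by
  rw [← Complex.normSq_eq_norm_sq, Complex.normSq_apply, Complex.re_sum, Complex.im_sum,
    Finset.sum_mul_sum, Finset.sum_mul_sum, ← Finset.sum_add_distrib]
  refine Finset.sum_congr rfl fun m _ => ?_
  rw [← Finset.sum_add_distrib]
  refine Finset.sum_congr rfl fun n _ => ?_
  rw [(natCast_cpow_re_im σ t m).1, (natCast_cpow_re_im σ t m).2, (natCast_cpow_re_im σ t n).1,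
    (natCast_cpow_re_im σ t n).2, sub_mul, Real.cos_sub, mul_comm (Real.log _) t,
    mul_comm (Real.log _) t]
  ring

lemma norm_sq_dirichlet_sum_sub_diag (σ t : ℝ) (s : Finset ℕ) :
    ‖∑ n ∈ s, ((n + 1 : ℕ) : ℂ) ^ (-(σ + t * Complex.I))‖ ^ 2 -
        ∑ n ∈ s, ((n + 1 : ℕ) : ℝ) ^ (-2 * σ) =
      ∑ m ∈ s, ∑ n ∈ s, if m = n then 0 else
        ((m + 1 : ℕ) : ℝ) ^ (-σ) * ((n + 1 : ℕ) : ℝ) ^ (-σ) *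
        Real.cos ((Real.log (m + 1 : ℕ) - Real.log (n + 1 : ℕ)) * t) := by
  rw [norm_sq_dirichlet_sum, ← Finset.sum_sub_distrib]
  refine Finset.sum_congr rfl fun m hm => ?_
  have h1 : ((m + 1 : ℕ) : ℝ) ^ (-2 * σ) = ∑ n ∈ s, if m = n then ((m + 1 : ℕ) : ℝ) ^ (-2 * σ) else 0 := by
    rw [Finset.sum_ite_eq, if_pos hm]
  rw [h1, ← Finset.sum_sub_distrib]
  refine Finset.sum_congr rfl fun n _ => ?_
  split_ifs with h
  · subst h
    rw [sub_self, zero_mul, Real.cos_zero, mul_one, ← Real.rpow_add (by positivity)]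
    ring_nf
  · ring

/-- Integration by parts: the weight is positive and decreasing, so the boundary terms `w(T) + w(b)`
and the total variation `w(b) - w(T)` add up to `2w(b)`. -/
lemma abs_integral_rpow_mul_cos_le {σ lam b T : ℝ} (hσ : σ ≤ 0) (hb : 0 < b) (hbT : b ≤ T)
    (hl : lam ≠ 0) :
    |∫ t in b..T, (t / (2 * π)) ^ σ * Real.cos (lam * t)| ≤ 2 * (b / (2 * π)) ^ σ / |lam| := by
  set w : ℝ → ℝ := fun t => (t / (2 * π)) ^ σ with hw
  set w' : ℝ → ℝ := fun t => (1 / (2 * π)) * σ * (t / (2 * π)) ^ (σ - 1) with hw'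
  have hpos : ∀ t ∈ Set.uIcc b T, 0 < t / (2 * π) := by
    intro t ht
    rw [Set.uIcc_of_le hbT] at ht
    have : 0 < t := hb.trans_le ht.1
    positivity
  have hwd : ∀ t ∈ Set.uIcc b T, HasDerivAt w (w' t) t := by
    intro t ht
    exact ((hasDerivAt_id t).div_const (2 * π)).rpow_const (Or.inl (hpos t ht).ne')
  have hvd : ∀ t ∈ Set.uIcc b T, HasDerivAt (fun t => Real.sin (lam * t) / lam) (Real.cos (lam * t)) t := by
    intro t _
    have := (((hasDerivAt_id t).const_mul lam).sin).div_const lam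
    refine this.congr_deriv ?_
    simp only [id, mul_one]
    field_simp
  have hw'c : ContinuousOn w' (Set.uIcc b T) := by
    refine continuousOn_const.mul (ContinuousOn.rpow_const (by fun_prop) fun t ht => Or.inl (hpos t ht).ne')
  have hw'i : IntervalIntegrable w' MeasureTheory.volume b T := hw'c.intervalIntegrable
  have hparts := intervalIntegral.integral_mul_deriv_eq_deriv_mul hwd hvd hw'i
    ((by fun_prop : Continuous fun t => Real.cos (lam * t)).intervalIntegrable _ _)
  have hw'neg : ∀ t ∈ Set.Icc b T, w' t ≤ 0 := by
    intro t ht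
    have := hpos t (by rwa [Set.uIcc_of_le hbT])
    have h1 : 0 ≤ (t / (2 * π)) ^ (σ - 1) := by positivity
    have h2 : (1 / (2 * π)) * σ ≤ 0 := mul_nonpos_of_nonneg_of_nonpos (by positivity) hσ
    exact mul_nonpos_of_nonpos_of_nonneg h2 h1
  have hftc : ∫ t in b..T, w' t = w T - w b := intervalIntegral.integral_eq_sub_of_hasDerivAt hwd hw'i
  have hbound : |∫ t in b..T, w' t * (Real.sin (lam * t) / lam)| ≤ (w b - w T) / |lam| := by
    have h1 : ‖∫ t in b..T, w' t * (Real.sin (lam * t) / lam)‖ ≤ ∫ t in b..T, -(w' t) / |lam| := by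
      refine intervalIntegral.norm_integral_le_of_norm_le hbT ?_ (hw'i.neg.div_const _)
      refine Filter.Eventually.of_forall fun t ht => ?_
      rw [norm_mul, norm_div, Real.norm_eq_abs, Real.norm_eq_abs, Real.norm_eq_abs,
        abs_of_nonpos (hw'neg t ⟨ht.1.le, ht.2⟩), mul_div_assoc', neg_mul, neg_mul_eq_mul_neg]
      have := hw'neg t ⟨ht.1.le, ht.2⟩
      gcongr
      have := Real.abs_sin_le_one (lam * t)
      nlinarith
    rw [intervalIntegral.integral_div, intervalIntegral.integral_neg, hftc, neg_sub] at h1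
    exact h1
  have hsin : ∀ t, |Real.sin (lam * t) / lam| ≤ 1 / |lam| := by
    intro t
    rw [abs_div]
    gcongr
    exact Real.abs_sin_le_one _
  have hwT : 0 ≤ w T := (Real.rpow_pos_of_pos (hpos T Set.right_mem_uIcc) _).le
  have hwb : 0 ≤ w b := (Real.rpow_pos_of_pos (hpos b Set.left_mem_uIcc) _).le
  have e : ∫ t in b..T, (t / (2 * π)) ^ σ * Real.cos (lam * t) = ∫ t in b..T, w t * Real.cos (lam * t) := rfl
  rw [e, hparts]
  calc _ ≤ |w T * (Real.sin (lam * T) / lam)| + |w b * (Real.sin (lam * b) / lam)| +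
        |∫ t in b..T, w' t * (Real.sin (lam * t) / lam)| :=
        (abs_sub _ _).trans (add_le_add_left (abs_sub _ _) _)
    _ ≤ w T * (1 / |lam|) + w b * (1 / |lam|) + (w b - w T) / |lam| := by
        rw [abs_mul, abs_mul, abs_of_nonneg hwT, abs_of_nonneg hwb]
        gcongr
        · exact hsin T
        · exact hsin b
    _ = 2 * w b / |lam| := by ring

/-- A harmonic sum, compared with the telescoping sum of `2(√(k + 1) - √k)`. A logarithm would be
sharper, but `√N` already matches the final error. -/
lemma sum_range_inv_sub_le (N : ℕ) : ∑ n ∈ Finset.range N, (1 : ℝ) / ((N : ℝ) - n) ≤ 2 * √N := by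
  have h1 : ∑ n ∈ Finset.range N, (1 : ℝ) / ((N : ℝ) - n) = ∑ n ∈ Finset.range N, (1 : ℝ) / (n + 1) := by
    rw [← Finset.sum_range_reflect]
    refine Finset.sum_congr rfl fun n hn => ?_
    have := Finset.mem_range.1 hn
    rw [show N - 1 - n = N - (n + 1) by omega, Nat.cast_sub (by omega)]
    push_cast; ring_nf
  rw [h1]
  clear h1
  induction N with
  | zero => simp
  | succ k ih =>
    rw [Finset.sum_range_succ]
    push_cast
    have h2 : √(k : ℝ) ≤ √(k + 1 : ℝ) := Real.sqrt_le_sqrt (by linarith)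
    have h3 : √(k : ℝ) ^ 2 = k := Real.sq_sqrt (by positivity)
    have h4 : √(k + 1 : ℝ) ^ 2 = k + 1 := Real.sq_sqrt (by positivity)
    have h5 : 1 ≤ √(k + 1 : ℝ) := Real.one_le_sqrt.2 (by linarith [Nat.cast_nonneg (α := ℝ) k])
    have h6 : (1 : ℝ) / (k + 1) ≤ 2 * (√(k + 1 : ℝ) - √(k : ℝ)) := by
      rw [div_le_iff₀ (by positivity)]
      have : (√(k + 1 : ℝ) - √(k : ℝ)) * (√(k + 1 : ℝ) + √(k : ℝ)) = 1 := by linear_combination h4 - h3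
      have h7 : 0 ≤ √(k + 1 : ℝ) - √(k : ℝ) := by linarith
      have h8 : √(k + 1 : ℝ) + √(k : ℝ) ≤ 2 * (k + 1) := by nlinarith
      nlinarith
    linarith

lemma sum_sum_inv_abs_sub_le (N : ℕ) :
    ∑ m ∈ Finset.range N, ∑ n ∈ Finset.range N, (if m = n then (0 : ℝ) else 1 / |(m : ℝ) - n|) ≤
      4 * (N * √N) := by
  induction N with
  | zero => simp
  -- Passing from `k` to `k + 1` adds one row and one column, each at most `2√k`.
  | succ k ih =>
    rw [Finset.sum_range_succ]
    simp_rw [Finset.sum_range_succ (n := k)]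
    rw [Finset.sum_add_distrib]
    have h1 : ∑ m ∈ Finset.range k, (if m = k then (0 : ℝ) else 1 / |(m : ℝ) - k|) ≤ 2 * √k := by
      refine (le_of_eq (Finset.sum_congr rfl fun m hm => ?_)).trans (sum_range_inv_sub_le k)
      have hm := Finset.mem_range.1 hm
      have : (m : ℝ) < k := by exact_mod_cast hm
      rw [if_neg hm.ne, abs_sub_comm, abs_of_pos (by linarith)]
    have h2 : ∑ n ∈ Finset.range k, (if k = n then (0 : ℝ) else 1 / |(k : ℝ) - n|) ≤ 2 * √k := by
      refine le_trans (le_of_eq (Finset.sum_congr rfl fun m _ => ?_)) h1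
      rw [abs_sub_comm]; simp only [eq_comm]
    have h3 : √(k : ℝ) ≤ √((k + 1 : ℕ) : ℝ) := Real.sqrt_le_sqrt (by push_cast; linarith)
    rw [if_pos trivial]
    push_cast at h3 ⊢
    nlinarith [Real.sqrt_nonneg (k : ℝ), Nat.cast_nonneg (α := ℝ) k]

lemma inv_abs_log_sub_log_le {x y M : ℝ} (hx : 0 < x) (hy : 0 < y) (hxM : x ≤ M) (hyM : y ≤ M)
    (hxy : x ≠ y) : 1 / |Real.log x - Real.log y| ≤ M * (1 / |x - y|) := by
  wlog h : y < x generalizing x y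
  · rw [abs_sub_comm, abs_sub_comm x y]
    exact this hy hx hyM hxM hxy.symm (lt_of_le_of_ne (not_lt.1 h) hxy)
  -- For `y < x`, `log(x/y) ≥ 1 - y/x = (x - y)/x ≥ (x - y)/M`.
  have hM : 0 < M := hx.trans_le hxM
  have h1 := Real.one_sub_inv_le_log_of_pos (div_pos hx hy)
  rw [Real.log_div hx.ne' hy.ne', inv_div] at h1
  have h2 : (x - y) / M ≤ Real.log x - Real.log y := by
    refine le_trans ?_ h1
    rw [one_sub_div hx.ne']
    exact div_le_div_of_nonneg_left (by linarith) hx hxM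
  have h3 : 0 < (x - y) / M := div_pos (by linarith) hM
  rw [abs_of_pos (h3.trans_le h2), abs_of_pos (by linarith)]
  calc 1 / (Real.log x - Real.log y) ≤ 1 / ((x - y) / M) := one_div_le_one_div_of_le h3 h2
    _ = M * (1 / (x - y)) := by rw [one_div_div]; ring

lemma abs_sum_rpow_sub_le {p y : ℝ} (hp : 0 < p) (hy : 0 ≤ y) :
    |∑ n ∈ Finset.range ⌊y⌋₊, ((n + 1 : ℕ) : ℝ) ^ p - y ^ (p + 1) / (p + 1)| ≤ y ^ p := by
  set L := ⌊y⌋₊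
  have hL1 : (L : ℝ) ≤ y := Nat.floor_le hy
  have hL2 : y < L + 1 := Nat.lt_floor_add_one y
  have hmono : MonotoneOn (fun x : ℝ => x ^ p) (Set.Icc (0 : ℝ) (0 + L)) := fun a ha b _ hab =>
    Real.rpow_le_rpow ha.1 hab hp.le
  have hint : ∀ a b : ℝ, ∫ x in a..b, x ^ p = (b ^ (p + 1) - a ^ (p + 1)) / (p + 1) := fun a b =>
    integral_rpow (Or.inl (by linarith))
  have hlow := hmono.integral_le_sum
  have hupp := hmono.sum_le_integral
  rw [hint, Real.zero_rpow (by linarith)] at hlow hupp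
  simp only [zero_add, sub_zero] at hlow hupp
  -- The integral over `[0, L]` dominates the sum of `n^p` over `n < L`; shifting the index by one
  -- costs `L^p ≤ y^p`.
  have hshift : ∑ n ∈ Finset.range L, ((n + 1 : ℕ) : ℝ) ^ p = ∑ n ∈ Finset.range L, (n : ℝ) ^ p + (L : ℝ) ^ p := by
    have h1 := Finset.sum_range_succ (fun n : ℕ => (n : ℝ) ^ p) L
    rw [Finset.sum_range_succ', Nat.cast_zero, Real.zero_rpow hp.ne', add_zero] at h1
    exact h1
  have hLp : (L : ℝ) ^ p ≤ y ^ p := Real.rpow_le_rpow (by positivity) hL1 hp.le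
  have hLp1 : (L : ℝ) ^ (p + 1) / (p + 1) ≤ y ^ (p + 1) / (p + 1) := by gcongr
  have htail : (y ^ (p + 1) - (L : ℝ) ^ (p + 1)) / (p + 1) ≤ y ^ p := by
    rw [← hint]
    have := intervalIntegral.norm_integral_le_of_norm_le_const (a := (L : ℝ)) (b := y)
      (f := fun x : ℝ => x ^ p) (C := y ^ p) ?_
    · refine (le_abs_self _).trans (this.trans ?_)
      rw [abs_of_nonneg (by linarith)]
      have : 0 ≤ y ^ p := by positivity
      nlinarith
    · intro x hx
      rw [Set.uIoc_of_le hL1] at hx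
      have hx0 : 0 ≤ x := (Nat.cast_nonneg L).trans hx.1.le
      rw [Real.norm_of_nonneg (by positivity)]
      exact Real.rpow_le_rpow hx0 hx.2 hp.le
  rw [sub_div] at htail
  rw [abs_le]
  constructor <;> linarith

/-! ### Weighted mean square of the Dirichlet polynomial. -/

/-- The Dirichlet polynomial `∑ n ^ (-s)` over `1 ≤ n ≤ √(t / 2π)`, at `s = σ + it`. -/
noncomputable def mainSum (σ t : ℝ) : ℂ :=
  ∑ n ∈ Finset.range ⌊√(t / (2 * π))⌋₊, ((n + 1 : ℕ) : ℂ) ^ (-(σ + t * Complex.I))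

/-- The diagonal part of `‖mainSum σ t‖ ^ 2`. -/
noncomputable def diagSum (σ t : ℝ) : ℝ :=
  ∑ n ∈ Finset.range ⌊√(t / (2 * π))⌋₊, ((n + 1 : ℕ) : ℝ) ^ (-2 * σ)

/-- An off-diagonal term of the weighted mean square. -/
noncomputable def offDiagTerm (σ : ℝ) (m n : ℕ) (t : ℝ) : ℝ :=
  if m = n then 0 else ((m + 1 : ℕ) : ℝ) ^ (-σ) * ((n + 1 : ℕ) : ℝ) ^ (-σ) *
    if 2 * π * ((max m n + 1 : ℕ) : ℝ) ^ 2 ≤ t then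
      (t / (2 * π)) ^ σ * Real.cos ((Real.log (m + 1 : ℕ) - Real.log (n + 1 : ℕ)) * t) else 0

lemma lt_floor_sqrt_iff (m : ℕ) (t : ℝ) :
    m < ⌊√(t / (2 * π))⌋₊ ↔ 2 * π * ((m + 1 : ℕ) : ℝ) ^ 2 ≤ t := by
  rw [← Nat.add_one_le_iff, Nat.le_floor_iff' (by omega), Real.le_sqrt' (by positivity),
    le_div_iff₀ (by positivity), mul_comm]

lemma sum_range_eq_sum_range_ite {M : Type*} [AddCommMonoid M] {L N : ℕ} (h : L ≤ N) (f : ℕ → M) :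
    ∑ n ∈ Finset.range L, f n = ∑ n ∈ Finset.range N, if n < L then f n else 0 := by
  rw [← Finset.sum_filter]
  refine Finset.sum_congr ?_ fun _ _ => rfl
  ext x; simp; omega

/-- The range of summation is made independent of `t`: the cutoff becomes an indicator inside each
term, so that sum and integral can be interchanged. -/
lemma norm_sq_mainSum_sub_diagSum_mul (σ : ℝ) {t T : ℝ} (htT : t ≤ T) :
    (‖mainSum σ t‖ ^ 2 - diagSum σ t) * (t / (2 * π)) ^ σ =
      ∑ m ∈ Finset.range ⌊√(T / (2 * π))⌋₊, ∑ n ∈ Finset.range ⌊√(T / (2 * π))⌋₊,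
        offDiagTerm σ m n t := by
  have hL : ⌊√(t / (2 * π))⌋₊ ≤ ⌊√(T / (2 * π))⌋₊ := by gcongr
  rw [mainSum, diagSum, norm_sq_dirichlet_sum_sub_diag, sum_range_eq_sum_range_ite hL,
    Finset.sum_mul]
  refine Finset.sum_congr rfl fun m _ => ?_
  have hpull : ∀ (p : Prop) [Decidable p] (f : ℕ → ℝ) (s : Finset ℕ),
      (if p then ∑ n ∈ s, f n else 0) = ∑ n ∈ s, if p then f n else 0 := by
    intro p _ f s; split_ifs <;> simp
  rw [sum_range_eq_sum_range_ite hL, ite_mul, zero_mul, Finset.sum_mul, hpull]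
  refine Finset.sum_congr rfl fun n _ => ?_
  have hmax : 2 * π * ((max m n + 1 : ℕ) : ℝ) ^ 2 ≤ t ↔
      m < ⌊√(t / (2 * π))⌋₊ ∧ n < ⌊√(t / (2 * π))⌋₊ := by
    rw [← lt_floor_sqrt_iff, max_lt_iff]
  rw [offDiagTerm]
  by_cases hm : m < ⌊√(t / (2 * π))⌋₊ <;> by_cases hn : n < ⌊√(t / (2 * π))⌋₊ <;>
    by_cases hmn : m = n <;> simp only [hmax, hm, hn, hmn, if_true, if_false, and_self, and_true,
      and_false, mul_zero, zero_mul]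
  ring

lemma integral_ite_le {f : ℝ → ℝ} {a b T : ℝ} (hab : a < b) (hbT : b ≤ T) :
    ∫ t in a..T, (if b ≤ t then f t else 0) = ∫ t in b..T, f t := by
  have h : (fun t => if b ≤ t then f t else 0) = (Set.Ici b).indicator f := by
    ext t; simp [Set.indicator_apply]
  rw [h, intervalIntegral.integral_of_le (hab.le.trans hbT), intervalIntegral.integral_of_le hbT,
    MeasureTheory.setIntegral_indicator measurableSet_Ici, ← MeasureTheory.integral_Icc_eq_integral_Ioc]
  congr 2
  ext t
  simp only [Set.mem_inter_iff, Set.mem_Ioc, Set.mem_Ici, Set.mem_Icc]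
  constructor
  · rintro ⟨⟨_, h1⟩, h2⟩; exact ⟨h2, h1⟩
  · rintro ⟨h1, h2⟩; exact ⟨⟨hab.trans_le h1, h2⟩, h1⟩

lemma intervalIntegrable_ite_le {f : ℝ → ℝ} {a b T : ℝ}
    (hf : IntervalIntegrable f MeasureTheory.volume a T) :
    IntervalIntegrable (fun t => if b ≤ t then f t else 0) MeasureTheory.volume a T := by
  have h : (fun t => if b ≤ t then f t else 0) = (Set.Ici b).indicator f := by
    ext t; simp [Set.indicator_apply]
  rw [h]
  exact ⟨hf.1.indicator measurableSet_Ici, hf.2.indicator measurableSet_Ici⟩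

lemma continuousOn_weight (σ : ℝ) {T : ℝ} (hT : 1 ≤ T) :
    ContinuousOn (fun t : ℝ => (t / (2 * π)) ^ σ) (Set.uIcc 1 T) := by
  refine ContinuousOn.rpow_const (by fun_prop) fun t ht => Or.inl ?_
  rw [Set.uIcc_of_le hT] at ht
  have : 0 < t := by linarith [ht.1]
  positivity

lemma intervalIntegrable_offDiagTerm (σ : ℝ) (m n : ℕ) {T : ℝ} (hT : 1 ≤ T) :
    IntervalIntegrable (offDiagTerm σ m n) MeasureTheory.volume 1 T := by
  by_cases hmn : m = n
  · have : offDiagTerm σ m n = fun _ => 0 := by ext t; simp [offDiagTerm, hmn]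
    rw [this]; exact intervalIntegrable_const
  · have e : offDiagTerm σ m n = fun t => ((m + 1 : ℕ) : ℝ) ^ (-σ) * ((n + 1 : ℕ) : ℝ) ^ (-σ) *
      if 2 * π * ((max m n + 1 : ℕ) : ℝ) ^ 2 ≤ t then
      (t / (2 * π)) ^ σ * Real.cos ((Real.log (m + 1 : ℕ) - Real.log (n + 1 : ℕ)) * t) else 0 := by
      ext t; rw [offDiagTerm, if_neg hmn]
    rw [e]
    refine (intervalIntegrable_ite_le (ContinuousOn.intervalIntegrable ?_)).const_mul _
    exact (continuousOn_weight σ hT).mul (by fun_prop)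

lemma abs_integral_offDiagTerm_le {σ : ℝ} (hσ : σ ≤ 0) {N m n : ℕ} (hm : m < N) (hn : n < N) {T : ℝ}
    (hNT : 2 * π * (N : ℝ) ^ 2 ≤ T) :
    |∫ t in (1 : ℝ)..T, offDiagTerm σ m n t| ≤
      2 * N * (if m = n then (0 : ℝ) else 1 / |(m : ℝ) - n|) := by
  by_cases hmn : m = n
  · simp [offDiagTerm, hmn]
  simp only [offDiagTerm, if_neg hmn]
  set M : ℕ := max m n + 1 with hM
  have hMN : M ≤ N := by omega
  have hM1 : (1 : ℝ) ≤ M := by exact_mod_cast (by omega : 1 ≤ M)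
  have hMN' : (M : ℝ) ≤ N := by exact_mod_cast hMN
  have hmM : ((m + 1 : ℕ) : ℝ) ≤ M := by exact_mod_cast (by omega)
  have hnM : ((n + 1 : ℕ) : ℝ) ≤ M := by exact_mod_cast (by omega)
  have hm0 : (0 : ℝ) < (m + 1 : ℕ) := by positivity
  have hn0 : (0 : ℝ) < (n + 1 : ℕ) := by positivity
  have hb1 : 1 < 2 * π * (M : ℝ) ^ 2 := by nlinarith [Real.pi_gt_three]
  have hbT : 2 * π * (M : ℝ) ^ 2 ≤ T := le_trans (by gcongr) hNT
  have hne : ((m + 1 : ℕ) : ℝ) ≠ (n + 1 : ℕ) := by exact_mod_cast (by omega)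
  have hlog : Real.log (m + 1 : ℕ) - Real.log (n + 1 : ℕ) ≠ 0 := by
    rw [sub_ne_zero]
    exact fun h => hne (Real.log_injOn_pos hm0 hn0 h)
  rw [intervalIntegral.integral_const_mul, integral_ite_le hb1 hbT, abs_mul,
    abs_of_nonneg (by positivity)]
  have h1 := abs_integral_rpow_mul_cos_le hσ (by linarith) hbT hlog
  have h2 := inv_abs_log_sub_log_le hm0 hn0 hmM hnM hne
  -- At the starting point `2πM²` the weight is `M^(2σ)`, which compensates the two coefficients
  -- since `m + 1, n + 1 ≤ M`.
  have h3 : (2 * π * (M : ℝ) ^ 2 / (2 * π)) ^ σ = (M : ℝ) ^ (2 * σ) := by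
    rw [mul_div_cancel_left₀ _ (by positivity), ← Real.rpow_natCast, ← Real.rpow_mul (by linarith)]
    norm_num
  have h4 : ((m + 1 : ℕ) : ℝ) ^ (-σ) * ((n + 1 : ℕ) : ℝ) ^ (-σ) * (M : ℝ) ^ (2 * σ) ≤ 1 := by
    calc _ ≤ (M : ℝ) ^ (-σ) * (M : ℝ) ^ (-σ) * (M : ℝ) ^ (2 * σ) := by
          have : 0 ≤ -σ := by linarith
          gcongr
      _ = 1 := by
          rw [← Real.rpow_add (by linarith), ← Real.rpow_add (by linarith)]
          ring_nf; simp
  rw [h3] at h1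
  have h5 : |((m + 1 : ℕ) : ℝ) - (n + 1 : ℕ)| = |(m : ℝ) - n| := by push_cast; ring_nf
  rw [h5] at h2
  calc _ ≤ ((m + 1 : ℕ) : ℝ) ^ (-σ) * ((n + 1 : ℕ) : ℝ) ^ (-σ) * (2 * (M : ℝ) ^ (2 * σ) /
        |Real.log (m + 1 : ℕ) - Real.log (n + 1 : ℕ)|) := by gcongr
    _ = 2 * (((m + 1 : ℕ) : ℝ) ^ (-σ) * ((n + 1 : ℕ) : ℝ) ^ (-σ) * (M : ℝ) ^ (2 * σ)) *
        (1 / |Real.log (m + 1 : ℕ) - Real.log (n + 1 : ℕ)|) := by ring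
    _ ≤ 2 * 1 * (M * (1 / |(m : ℝ) - n|)) := by gcongr
    _ ≤ 2 * 1 * (N * (1 / |(m : ℝ) - n|)) := by gcongr
    _ = _ := by ring

lemma intervalIntegrable_offDiag (σ : ℝ) {T : ℝ} (hT : 1 ≤ T) :
    IntervalIntegrable (fun t => (‖mainSum σ t‖ ^ 2 - diagSum σ t) * (t / (2 * π)) ^ σ)
      MeasureTheory.volume 1 T := by
  have h : IntervalIntegrable (fun t => ∑ m ∈ Finset.range ⌊√(T / (2 * π))⌋₊,
      ∑ n ∈ Finset.range ⌊√(T / (2 * π))⌋₊, offDiagTerm σ m n t) MeasureTheory.volume 1 T := by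
    have := IntervalIntegrable.sum (μ := MeasureTheory.volume) (a := 1) (b := T)
      (Finset.range ⌊√(T / (2 * π))⌋₊ ×ˢ Finset.range ⌊√(T / (2 * π))⌋₊)
      (f := fun p => offDiagTerm σ p.1 p.2) fun p _ => intervalIntegrable_offDiagTerm σ p.1 p.2 hT
    refine this.congr fun t _ => ?_
    rw [Finset.sum_apply, Finset.sum_product]
  refine h.congr fun t ht => ?_
  rw [Set.uIoc_of_le hT] at ht
  exact (norm_sq_mainSum_sub_diagSum_mul σ ht.2).symm

lemma abs_integral_offDiag_le {σ : ℝ} (hσ : σ ≤ 0) {T : ℝ} (hT : 1 ≤ T) :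
    |∫ t in (1 : ℝ)..T, (‖mainSum σ t‖ ^ 2 - diagSum σ t) * (t / (2 * π)) ^ σ| ≤
      8 * T ^ (5 / 4 : ℝ) := by
  set N := ⌊√(T / (2 * π))⌋₊ with hN
  have hTpos : 0 < T := by linarith
  have hy : 0 ≤ T / (2 * π) := by positivity
  have hNs : (N : ℝ) ≤ √(T / (2 * π)) := Nat.floor_le (Real.sqrt_nonneg _)
  have hNT : 2 * π * (N : ℝ) ^ 2 ≤ T := by
    have h1 : (N : ℝ) ^ 2 ≤ T / (2 * π) := (Real.le_sqrt (by positivity) hy).1 hNs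
    rw [le_div_iff₀ (by positivity)] at h1
    linarith
  have hNT' : (N : ℝ) ≤ T ^ (1 / 2 : ℝ) := by
    refine hNs.trans ?_
    rw [← Real.sqrt_eq_rpow]
    refine Real.sqrt_le_sqrt (div_le_self hTpos.le ?_)
    nlinarith [Real.pi_gt_three]
  have hsum : ∫ t in (1 : ℝ)..T, (‖mainSum σ t‖ ^ 2 - diagSum σ t) * (t / (2 * π)) ^ σ =
      ∑ m ∈ Finset.range N, ∑ n ∈ Finset.range N, ∫ t in (1 : ℝ)..T, offDiagTerm σ m n t := by
    rw [intervalIntegral.integral_congr (g := fun t => ∑ m ∈ Finset.range N,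
      ∑ n ∈ Finset.range N, offDiagTerm σ m n t)]
    · rw [← Finset.sum_product', ← intervalIntegral.integral_finsetSum
        fun p _ => intervalIntegrable_offDiagTerm σ p.1 p.2 hT]
      simp_rw [Finset.sum_product]
    · intro t ht
      rw [Set.uIcc_of_le hT] at ht
      exact norm_sq_mainSum_sub_diagSum_mul σ ht.2
  rw [hsum]
  calc _ ≤ ∑ m ∈ Finset.range N, ∑ n ∈ Finset.range N, |∫ t in (1 : ℝ)..T, offDiagTerm σ m n t| :=
        (Finset.abs_sum_le_sum_abs _ _).trans
          (Finset.sum_le_sum fun m _ => Finset.abs_sum_le_sum_abs _ _)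
    _ ≤ ∑ m ∈ Finset.range N, ∑ n ∈ Finset.range N,
        2 * N * (if m = n then (0 : ℝ) else 1 / |(m : ℝ) - n|) :=
        Finset.sum_le_sum fun m hm => Finset.sum_le_sum fun n hn =>
          abs_integral_offDiagTerm_le hσ (Finset.mem_range.1 hm) (Finset.mem_range.1 hn) hNT
    _ = 2 * N * ∑ m ∈ Finset.range N, ∑ n ∈ Finset.range N,
        (if m = n then (0 : ℝ) else 1 / |(m : ℝ) - n|) := by simp_rw [Finset.mul_sum]
    _ ≤ 2 * N * (4 * (N * √N)) := by
        gcongr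
        exact sum_sum_inv_abs_sub_le N
    _ ≤ 2 * T ^ (1 / 2 : ℝ) * (4 * (T ^ (1 / 2 : ℝ) * T ^ (1 / 4 : ℝ))) := by
        have : √(N : ℝ) ≤ T ^ (1 / 4 : ℝ) := by
          refine (Real.sqrt_le_sqrt hNT').trans (le_of_eq ?_)
          rw [Real.sqrt_eq_rpow, ← Real.rpow_mul hTpos.le]; norm_num
        gcongr
    _ = 8 * T ^ (5 / 4 : ℝ) := by
        have : T ^ (5 / 4 : ℝ) = T ^ (1 / 2 : ℝ) * (T ^ (1 / 2 : ℝ) * T ^ (1 / 4 : ℝ)) := by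
          rw [← Real.rpow_add hTpos, ← Real.rpow_add hTpos]; norm_num
        rw [this]; ring

/-- With `y = √(t/2π)`, the error `y^(-2σ)` in comparing the sum with its integral is exactly
cancelled by the weight `y^(2σ)`. -/
lemma abs_diagSum_mul_sub_le {σ : ℝ} (hσ : σ < 0) {t : ℝ} (ht : 0 < t) :
    |diagSum σ t * (t / (2 * π)) ^ σ - (t / (2 * π)) ^ (1 / 2 : ℝ) / (1 - 2 * σ)| ≤ 1 := by
  have hy : 0 < t / (2 * π) := by positivity
  have h := abs_sum_rpow_sub_le (p := -2 * σ) (y := √(t / (2 * π))) (by linarith) (Real.sqrt_nonneg _)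
  have hw : 0 < (t / (2 * π)) ^ σ := by positivity
  have h1 : √(t / (2 * π)) ^ (-2 * σ) = (t / (2 * π)) ^ (-σ) := by
    rw [Real.sqrt_eq_rpow, ← Real.rpow_mul hy.le]; ring_nf
  have h2 : √(t / (2 * π)) ^ (-2 * σ + 1) = (t / (2 * π)) ^ (-σ) * (t / (2 * π)) ^ (1 / 2 : ℝ) := by
    rw [Real.sqrt_eq_rpow, ← Real.rpow_mul hy.le, ← Real.rpow_add hy]; ring_nf
  have h3 : (t / (2 * π)) ^ (-σ) * (t / (2 * π)) ^ σ = 1 := by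
    rw [← Real.rpow_add hy]; simp
  rw [h1, h2, show -2 * σ + 1 = 1 - 2 * σ by ring] at h
  have e : diagSum σ t * (t / (2 * π)) ^ σ - (t / (2 * π)) ^ (1 / 2 : ℝ) / (1 - 2 * σ) =
      (diagSum σ t - (t / (2 * π)) ^ (-σ) * (t / (2 * π)) ^ (1 / 2 : ℝ) / (1 - 2 * σ)) *
        (t / (2 * π)) ^ σ := by
    linear_combination ((t / (2 * π)) ^ (1 / 2 : ℝ) / (1 - 2 * σ)) * h3
  rw [e, abs_mul, abs_of_pos hw]
  exact (mul_le_mul_of_nonneg_right h hw.le).trans h3.le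

lemma measurable_diagSum (σ : ℝ) : Measurable (diagSum σ) := by
  have h : Measurable fun L : ℕ => ∑ n ∈ Finset.range L, ((n + 1 : ℕ) : ℝ) ^ (-2 * σ) :=
    measurable_from_nat
  exact h.comp (Nat.measurable_floor.comp (by fun_prop))

lemma intervalIntegrable_diagSum_mul {σ : ℝ} (hσ : σ < 0) {T : ℝ} (hT : 1 ≤ T) :
    IntervalIntegrable (fun t => diagSum σ t * (t / (2 * π)) ^ σ) MeasureTheory.volume 1 T := by
  have h1 : IntervalIntegrable (fun t : ℝ => 1 + (t / (2 * π)) ^ (1 / 2 : ℝ) / (1 - 2 * σ))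
      MeasureTheory.volume 1 T :=
    (continuousOn_const.add ((continuousOn_weight (1 / 2) hT).div_const _)).intervalIntegrable
  refine h1.mono_fun' (((measurable_diagSum σ).mul (by fun_prop)).aestronglyMeasurable) ?_
  refine (MeasureTheory.ae_restrict_iff' measurableSet_uIoc).2 (Filter.Eventually.of_forall ?_)
  intro t ht
  rw [Set.uIoc_of_le hT] at ht
  have ht0 : 0 < t := by linarith [ht.1]
  have := abs_le.1 (abs_diagSum_mul_sub_le hσ ht0)
  have h2 : 0 ≤ diagSum σ t * (t / (2 * π)) ^ σ :=
    mul_nonneg (Finset.sum_nonneg fun n _ => by positivity) (by positivity)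
  change ‖diagSum σ t * (t / (2 * π)) ^ σ‖ ≤ 1 + (t / (2 * π)) ^ (1 / 2 : ℝ) / (1 - 2 * σ)
  rw [Real.norm_of_nonneg h2]
  linarith [this.2]

lemma integral_sqrt_weight {T : ℝ} (hT : 1 ≤ T) :
    ∫ t in (1 : ℝ)..T, (t / (2 * π)) ^ (1 / 2 : ℝ) =
      2 / 3 * (1 / (2 * π)) ^ (1 / 2 : ℝ) * (T ^ (3 / 2 : ℝ) - 1) := by
  have h : ∫ t in (1 : ℝ)..T, (t / (2 * π)) ^ (1 / 2 : ℝ) =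
      ∫ t in (1 : ℝ)..T, (1 / (2 * π)) ^ (1 / 2 : ℝ) * t ^ (1 / 2 : ℝ) := by
    refine intervalIntegral.integral_congr fun t ht => ?_
    rw [Set.uIcc_of_le hT] at ht
    have ht0 : 0 ≤ t := by linarith [ht.1]
    rw [← Real.mul_rpow (by positivity) ht0]
    ring_nf
  rw [h, intervalIntegral.integral_const_mul, integral_rpow (Or.inl (by norm_num)), Real.one_rpow]
  norm_num
  ring

/-- The weighted mean square of the Dirichlet polynomial. -/
lemma exists_abs_integral_mainSum_sub_le {σ : ℝ} (hσ : σ < 0) :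
    ∃ C, 0 ≤ C ∧ ∀ T : ℝ, 1 ≤ T →
      IntervalIntegrable (fun t => ‖mainSum σ t‖ ^ 2 * (t / (2 * π)) ^ σ) MeasureTheory.volume 1 T ∧
      |(∫ t in (1 : ℝ)..T, ‖mainSum σ t‖ ^ 2 * (t / (2 * π)) ^ σ) -
        2 / (3 * (1 - 2 * σ)) * (1 / (2 * π)) ^ (1 / 2 : ℝ) * T ^ (3 / 2 : ℝ)| ≤
        C * T ^ (5 / 4 : ℝ) := by
  set c := 2 / (3 * (1 - 2 * σ)) * (1 / (2 * π)) ^ (1 / 2 : ℝ) with hc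
  have h12 : 0 < 1 - 2 * σ := by linarith
  have hc0 : 0 ≤ c := by positivity
  -- `8` comes from the off-diagonal terms, `1` from the diagonal error `T - 1`, and `c` from the
  -- lower endpoint `t = 1` of the main integral.
  refine ⟨9 + c, by positivity, fun T hT => ?_⟩
  have hsplit : ∀ t, ‖mainSum σ t‖ ^ 2 * (t / (2 * π)) ^ σ =
      (‖mainSum σ t‖ ^ 2 - diagSum σ t) * (t / (2 * π)) ^ σ + diagSum σ t * (t / (2 * π)) ^ σ := by
    intro t; ring
  have hi1 := intervalIntegrable_offDiag σ hT
  have hi2 := intervalIntegrable_diagSum_mul hσ hT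
  have hi3 : IntervalIntegrable (fun t : ℝ => (t / (2 * π)) ^ (1 / 2 : ℝ) / (1 - 2 * σ))
      MeasureTheory.volume 1 T := ((continuousOn_weight (1 / 2) hT).div_const _).intervalIntegrable
  simp_rw [hsplit]
  refine ⟨hi1.add hi2, ?_⟩
  rw [intervalIntegral.integral_add hi1 hi2]
  have ho := abs_integral_offDiag_le hσ.le hT
  have hd : |(∫ t in (1 : ℝ)..T, diagSum σ t * (t / (2 * π)) ^ σ) - c * (T ^ (3 / 2 : ℝ) - 1)| ≤ T - 1 := by
    have e : c * (T ^ (3 / 2 : ℝ) - 1) = ∫ t in (1 : ℝ)..T, (t / (2 * π)) ^ (1 / 2 : ℝ) / (1 - 2 * σ) := by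
      rw [intervalIntegral.integral_div, integral_sqrt_weight hT, hc]
      field_simp
    rw [e, ← intervalIntegral.integral_sub hi2 hi3]
    have := intervalIntegral.norm_integral_le_of_norm_le_const (a := 1) (b := T) (C := 1)
      (f := fun t => diagSum σ t * (t / (2 * π)) ^ σ - (t / (2 * π)) ^ (1 / 2 : ℝ) / (1 - 2 * σ)) ?_
    · rwa [abs_of_nonneg (by linarith), one_mul] at this
    · intro t ht
      rw [Set.uIoc_of_le hT] at ht
      exact abs_diagSum_mul_sub_le hσ (by linarith [ht.1])
  have hT1 : T ≤ T ^ (5 / 4 : ℝ) := by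
    conv_lhs => rw [← Real.rpow_one T]
    exact Real.rpow_le_rpow_of_exponent_le hT (by norm_num)
  have hcT : c ≤ c * T ^ (5 / 4 : ℝ) := le_mul_of_one_le_right hc0 (hT.trans hT1)
  rw [abs_le] at ho hd ⊢
  constructor <;> nlinarith [ho.1, ho.2, hd.1, hd.2]

/-! ### From the Dirichlet polynomial to `R(s)`. -/

lemma measurable_auxR_line (σ : ℝ) : Measurable fun t : ℝ => auxR (σ + t * Complex.I) := by
  have hm : Measurable fun p : ℝ × ℝ => ((σ + p.1 * Complex.I : ℂ),
      (1 / 2 + p.2 * Complex.exp (π * Complex.I / 4) : ℂ)) := by fun_prop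
  have h := ((measurable_auxIntegrand.comp hm).mul_const
    (Complex.exp (π * Complex.I / 4))).stronglyMeasurable
  exact (MeasureTheory.StronglyMeasurable.integral_prod_right (ν := MeasureTheory.volume) h).measurable.neg

/-- `R(s)` is a Dirichlet polynomial up to an error `O(t ^ (-σ / 2))`. -/
lemma exists_norm_auxR_sub_mainSum_le {σ : ℝ} (hσ : σ ≤ 0) :
    ∃ K, 0 ≤ K ∧ ∀ t : ℝ, 1 ≤ t →
      ‖auxR (σ + t * Complex.I) - mainSum σ t‖ ≤ K * (t / (2 * π)) ^ (-σ / 2) := by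
  obtain ⟨K, hK0, hK⟩ := exists_norm_auxLine_le hσ
  refine ⟨K, hK0, fun t ht => ?_⟩
  rw [auxR_eq_sum_sub_auxLine (by simpa using hσ) ⌊√(t / (2 * π))⌋₊, mainSum, sub_sub_cancel_left,
    norm_neg]
  exact hK t ht

/-- With `m` the modulus of the polynomial and `e` that of the error, `2me ≤ m²/q + qe²`, and `e²`
times the weight is bounded. The parameter `q` is left free in order to balance the two terms after
integration. -/
lemma exists_abs_norm_sq_sub_le {σ : ℝ} (hσ : σ ≤ 0) :
    ∃ K, 0 ≤ K ∧ ∀ t : ℝ, 1 ≤ t → ∀ q : ℝ, 1 ≤ q →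
      |‖auxR (σ + t * Complex.I)‖ ^ 2 * (t / (2 * π)) ^ σ -
        ‖mainSum σ t‖ ^ 2 * (t / (2 * π)) ^ σ| ≤
        q⁻¹ * (‖mainSum σ t‖ ^ 2 * (t / (2 * π)) ^ σ) + K * q := by
  obtain ⟨K, hK0, hK⟩ := exists_norm_auxR_sub_mainSum_le hσ
  refine ⟨2 * K ^ 2, by positivity, fun t ht q hq => ?_⟩
  have hy : 0 < t / (2 * π) := by positivity
  set w := (t / (2 * π)) ^ σ with hw
  have hw0 : 0 < w := by positivity
  have hd := hK t ht
  set r := ‖auxR (σ + t * Complex.I)‖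
  set m := ‖mainSum σ t‖
  set e := ‖auxR (σ + t * Complex.I) - mainSum σ t‖
  have hr0 : 0 ≤ r := norm_nonneg _
  have hm0 : 0 ≤ m := norm_nonneg _
  have he0 : 0 ≤ e := norm_nonneg _
  have hrm : |r - m| ≤ e := abs_norm_sub_norm_le _ _
  have hew : e ^ 2 * w ≤ K ^ 2 := by
    calc e ^ 2 * w ≤ (K * (t / (2 * π)) ^ (-σ / 2)) ^ 2 * w := by gcongr
      _ = K ^ 2 := by
        rw [mul_pow, ← Real.rpow_natCast ((t / (2 * π)) ^ (-σ / 2)), ← Real.rpow_mul hy.le, mul_assoc,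
          hw, ← Real.rpow_add hy]
        ring_nf; simp
  have hq0 : 0 < q := by linarith
  have h1 : |r ^ 2 - m ^ 2| ≤ e * (2 * m + e) := by
    rw [sq_sub_sq, abs_mul, abs_of_nonneg (by positivity), mul_comm]
    have := (abs_le.1 hrm).2
    refine mul_le_mul hrm (by linarith) (by positivity) he0
  have h2 : 2 * m * e ≤ q⁻¹ * m ^ 2 + q * e ^ 2 := by
    have : 0 ≤ q⁻¹ * (m - q * e) ^ 2 := by positivity
    have h3 : q⁻¹ * (m - q * e) ^ 2 = q⁻¹ * m ^ 2 + q * e ^ 2 - 2 * m * e := by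
      field_simp; ring
    linarith
  have h4 : |r ^ 2 - m ^ 2| ≤ q⁻¹ * m ^ 2 + 2 * q * e ^ 2 := by nlinarith [sq_nonneg e]
  rw [← sub_mul, abs_mul, abs_of_pos hw0]
  calc |r ^ 2 - m ^ 2| * w ≤ (q⁻¹ * m ^ 2 + 2 * q * e ^ 2) * w := by gcongr
    _ = q⁻¹ * (m ^ 2 * w) + 2 * q * (e ^ 2 * w) := by ring
    _ ≤ q⁻¹ * (m ^ 2 * w) + 2 * q * K ^ 2 := by gcongr
    _ = _ := by ring

lemma exists_abs_integral_auxR_sub_le {σ : ℝ} (hσ : σ < 0) :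
    ∃ C, ∀ T : ℝ, 1 ≤ T →
      |(∫ t in (1 : ℝ)..T, ‖auxR (σ + t * Complex.I)‖ ^ 2 * (t / (2 * π)) ^ σ) -
        2 / (3 * (1 - 2 * σ)) * (1 / (2 * π)) ^ (1 / 2 : ℝ) * T ^ (3 / 2 : ℝ)| ≤
        C * T ^ (5 / 4 : ℝ) := by
  obtain ⟨C, hC0, hC⟩ := exists_abs_integral_mainSum_sub_le hσ
  obtain ⟨K, hK0, hK⟩ := exists_abs_norm_sq_sub_le hσ.le
  set c := 2 / (3 * (1 - 2 * σ)) * (1 / (2 * π)) ^ (1 / 2 : ℝ) with hc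
  refine ⟨C + (c + C) + K, fun T hT => ?_⟩
  have hT0 : 0 < T := by linarith
  obtain ⟨hi, hb⟩ := hC T hT
  set f := fun t : ℝ => ‖auxR (σ + t * Complex.I)‖ ^ 2 * (t / (2 * π)) ^ σ with hf
  set g := fun t : ℝ => ‖mainSum σ t‖ ^ 2 * (t / (2 * π)) ^ σ with hg
  -- This choice balances `T^(3/2)/q` against `qT`; both equal `T^(5/4)`.
  set q := T ^ (1 / 4 : ℝ) with hq
  have hq1 : 1 ≤ q := Real.one_le_rpow hT (by norm_num)
  have hq0 : 0 < q := by linarith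
  have hbound : ∀ q : ℝ, IntervalIntegrable (fun t => q⁻¹ * g t + K * q) MeasureTheory.volume 1 T :=
    fun q => (hi.const_mul _).add intervalIntegrable_const
  have hfm : Measurable f := by
    have := measurable_auxR_line σ
    fun_prop
  have hfi : IntervalIntegrable f MeasureTheory.volume 1 T := by
    -- The pointwise comparison with `q = 1` provides an integrable majorant.
    refine (hi.add (hbound 1)).mono_fun' hfm.aestronglyMeasurable ?_
    refine (MeasureTheory.ae_restrict_iff' measurableSet_uIoc).2 (Filter.Eventually.of_forall ?_)
    intro t ht
    rw [Set.uIoc_of_le hT] at ht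
    have h1 := (abs_le.1 (hK t ht.1.le 1 le_rfl)).2
    have ht0 : 0 < t := by linarith [ht.1]
    have h2 : 0 ≤ f t := by simp only [hf]; positivity
    change ‖f t‖ ≤ g t + (1⁻¹ * g t + K * 1)
    rw [Real.norm_of_nonneg h2]
    change f t - g t ≤ 1⁻¹ * g t + K * 1 at h1
    linarith
  have hdiff : |(∫ t in (1 : ℝ)..T, f t) - ∫ t in (1 : ℝ)..T, g t| ≤
      q⁻¹ * (∫ t in (1 : ℝ)..T, g t) + K * q * (T - 1) := by
    rw [← intervalIntegral.integral_sub hfi hi]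
    have h1 : ‖∫ t in (1 : ℝ)..T, (f t - g t)‖ ≤ ∫ t in (1 : ℝ)..T, (q⁻¹ * g t + K * q) := by
      refine intervalIntegral.norm_integral_le_of_norm_le hT ?_ (hbound q)
      exact Filter.Eventually.of_forall fun t ht => hK t ht.1.le q hq1
    rw [intervalIntegral.integral_add (hi.const_mul _) intervalIntegrable_const,
      intervalIntegral.integral_const_mul, intervalIntegral.integral_const, smul_eq_mul] at h1
    rw [Real.norm_eq_abs] at h1
    linarith
  have e1 : T ^ (5 / 4 : ℝ) = q * T := by
    conv_rhs => rw [← Real.rpow_one T]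
    rw [hq, Real.rpow_one, ← Real.rpow_add_one hT0.ne']; norm_num
  have e2 : T ^ (3 / 2 : ℝ) = q * T ^ (5 / 4 : ℝ) := by
    rw [hq, ← Real.rpow_add hT0]; norm_num
  have hg1 : q⁻¹ * (∫ t in (1 : ℝ)..T, g t) ≤ (c + C) * T ^ (5 / 4 : ℝ) := by
    rw [inv_mul_le_iff₀ hq0]
    have h1 := (abs_le.1 hb).2
    have h2 : C * T ^ (5 / 4 : ℝ) ≤ C * T ^ (3 / 2 : ℝ) :=
      mul_le_mul_of_nonneg_left (Real.rpow_le_rpow_of_exponent_le hT (by norm_num)) hC0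
    rw [e2] at h1 h2
    linarith
  have hKq : K * q * (T - 1) ≤ K * T ^ (5 / 4 : ℝ) := by
    rw [e1, mul_assoc]
    gcongr
    linarith
  calc _ ≤ |(∫ t in (1 : ℝ)..T, f t) - ∫ t in (1 : ℝ)..T, g t| +
        |(∫ t in (1 : ℝ)..T, g t) - c * T ^ (3 / 2 : ℝ)| := abs_sub_le _ _ _
    _ ≤ (C + (c + C) + K) * T ^ (5 / 4 : ℝ) := by linarith

theorem theorem2 (σ : ℝ) (hσ : σ < 0) :
    (fun T : ℝ =>
        (1 / T) * (∫ t in (1 : ℝ)..T, ‖auxR (σ + t * Complex.I)‖ ^ 2 * (t / (2 * π)) ^ σ)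
          - 2 / (3 * (1 - 2 * σ)) * (T / (2 * π)) ^ (1 / 2 : ℝ))
      =O[Filter.atTop] (fun T : ℝ => T ^ (1 / 4 : ℝ)) := by
  obtain ⟨C, hC⟩ := exists_abs_integral_auxR_sub_le hσ
  refine Asymptotics.IsBigO.of_bound C ?_
  filter_upwards [Filter.eventually_ge_atTop 1] with T hT
  have hT0 : 0 < T := by linarith
  have h := hC T hT
  have e1 : T ^ (5 / 4 : ℝ) = T ^ (1 / 4 : ℝ) * T := by
    rw [← Real.rpow_add_one hT0.ne']; norm_num
  have e2 : T ^ (3 / 2 : ℝ) = T ^ (1 / 2 : ℝ) * T := by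
    rw [← Real.rpow_add_one hT0.ne']; norm_num
  have e3 : (T / (2 * π)) ^ (1 / 2 : ℝ) = (1 / (2 * π)) ^ (1 / 2 : ℝ) * T ^ (1 / 2 : ℝ) := by
    rw [← Real.mul_rpow (by positivity) hT0.le]; ring_nf
  rw [e1, e2] at h
  rw [e3, Real.norm_eq_abs, Real.norm_of_nonneg (by positivity)]
  set J := ∫ t in (1 : ℝ)..T, ‖auxR (σ + t * Complex.I)‖ ^ 2 * (t / (2 * π)) ^ σ
  have e4 : 1 / T * J - 2 / (3 * (1 - 2 * σ)) * ((1 / (2 * π)) ^ (1 / 2 : ℝ) * T ^ (1 / 2 : ℝ)) =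
      (J - 2 / (3 * (1 - 2 * σ)) * (1 / (2 * π)) ^ (1 / 2 : ℝ) * (T ^ (1 / 2 : ℝ) * T)) / T := by
    rw [sub_div]
    congr 1
    · ring
    · rw [eq_div_iff hT0.ne']; ring
  rw [e4, abs_div, abs_of_pos hT0, div_le_iff₀ hT0]
  linarith
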